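/- Let $M$ be a closed smooth manifold, let $f^\alpha,f^\beta:M\to\mathbb{R}$ be Morse functions and $g^\alpha,g^\beta$ smooth Riemannian metrics on $M$, let $\ell\ge 0$, and let $(H,G)=(H_{[\ell]},G_{[\ell]})$ be a finite homotopy between $(f^\alpha,g^\alpha)$ and $(f^\beta,g^\beta)$ with parameters in $[0,1]^\ell$: $H:[0,1]^\ell\times\mathbb{R}\times M\to\mathbb{R}$ is smooth, $G(\mathbf{s},t)$ is a Riemannian metric on $M$ depending smoothly on $(\mathbf{s},t)\in[0,1]^\ell\times\mathbb{R}$ and on the point of $M$, and there is $T>0$ such that $(H(\mathbf{s},t,\cdot),G(\mathbf{s},t))$ equals $(f^\alpha,g^\alpha)$ for $t<-T$ and $(f^\beta,g^\beta)$ for $t>T$, for every $\mathbf{s}$. For $c,c'\in M$ let $\mathcal{P}^{1,2}_{c,c'}$ be the space of $W^{1,2}$-paths $u:\mathbb{R}\to M$ with $u(t)\to c$ as $t\to-\infty$ and $u(t)\to c'$ as $t\to+\infty$. Put $$\mathcal{M}^{H}_{c,c'}=\{(\mathbf{s},u)\in[0,1]^\ell\times\mathcal{P}^{1,2}_{c,c'}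 : \dot u(t)=-\nabla_{G(\mathbf{s},t)}H(\mathbf{s},t,u(t))\ \text{for all } t\in\mathbb{R}\}$$ with the topology of $[0,1]^\ell\times\mathcal{P}^{1,2}_{c,c'}$. For $(f,g)=(f^\alpha,g^\alpha)$ or $(f^\beta,g^\beta)$, an $f$-trajectory from $c$ to $c'$ is a $u\in\mathcal{P}^{1,2}_{c,c'}$ with $\dot u=-\nabla_g f(u)$. Let $p\in \mathrm{Cr}\,f^\alpha$ and $q\in \mathrm{Cr}\,f^\beta$. A broken gradient flow line from $p$ to $q$ is a tuple $y=\{u^1,\dots,u^{k_0-1},(\mathbf{s}_0,u^{k_0}),u^{k_0+1},\dots,u^n\}$ with $n\ge 2$ and $1\le k_0\le n$, for which there are points $c_0=p,c_1,\dots,c_n=q$ of $M$, with $c_k\in \mathrm{Cr}\,f^\alpha$ for $k<k_0$ and $c_k\in \mathrm{Cr}\,f^\beta$ for $k\ge k_0$, such that $u^k$ is a non-constant $f^\alpha$-trajectory from $c_{k-1}$ to $c_k$ for $k<k_0$, $(\mathbf{s}_0,u^{k_0})\in\mathcal{M}^{H}_{c_{k_0-1},c_{k_0}}$ (where $u^{k_0}$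 may be constant), and $u^k$ is a non-constant $f^\beta$-trajectory from $c_{k-1}$ to $c_k$ for $k>k_0$. A sequence $(\mathbf{s}_j,u_j)$ Floer–Gromov converges to $y$ if $\mathbf{s}_j\to\mathbf{s}_0$ and there are real numbers $r^k_j$, with $r^{k_0}_j=0$ for all $j$, such that $u_j(\cdot+r^k_j)\to u^k$ in $C^\infty_{loc}(\mathbb{R},M)$ as $j\to\infty$ for every $1\le k\le n$. Theorem. Every sequence $(\mathbf{s}_\nu,u_\nu)_\nu$ in $\mathcal{M}^{H}_{p,q}$ has a subsequence $(\mathbf{s}_{\nu_j},u_{\nu_j})_j$ that, if it does not converge in $\mathcal{M}^{H}_{p,q}$, Floer–Gromov converges to a broken gradient flow line from $p$ to $q$. -/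

import Mathlib

open Set Filter Topology MeasureTheory
open scoped Manifold ContDiff ENNReal

noncomputable section

namespace HigherMorse

/-- The model space of an `m`-dimensional manifold. -/
abbrev Model (m : ℕ) : Type := EuclideanSpace ℝ (Fin m)

section Basics

variable {m : ℕ} {M : Type*} [TopologicalSpace M] [ChartedSpace (Model m) M]
  [IsManifold 𝓘(ℝ, Model m) ∞ M]

variable (m M) in
/-- Smooth Riemannian metrics on the manifold `M`. -/
abbrev Metric : Type _ :=
  Bundle.ContMDiffRiemannianMetric 𝓘(ℝ, Model m) ∞ (Model m)
    (fun x : M ↦ TangentSpace 𝓘(ℝ, Model m) x)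

/-- A Riemannian metric identifies covectors with vectors. -/
theorem existsUnique_inner_eq (g : Metric m M) (x : M)
    (L : TangentSpace 𝓘(ℝ, Model m) x →L[ℝ] ℝ) :
    ∃! v : TangentSpace 𝓘(ℝ, Model m) x, ∀ w, g.inner x v w = L w := by
  let B : Model m →ₗ[ℝ] Module.Dual ℝ (Model m) :=
    { toFun := fun v ↦ (g.inner x v).toLinearMap
      map_add' := fun v w ↦ LinearMap.ext fun y ↦
        congrArg (fun L : TangentSpace 𝓘(ℝ, Model m) x →L[ℝ] ℝ ↦ L y) ((g.inner x).map_add v w)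
      map_smul' := fun c v ↦ LinearMap.ext fun y ↦
        congrArg (fun L : TangentSpace 𝓘(ℝ, Model m) x →L[ℝ] ℝ ↦ L y) ((g.inner x).map_smul c v) }
  have hinj : Function.Injective B := by
    rw [injective_iff_map_eq_zero]
    intro v hv
    by_contra hne
    have h1 := g.pos x v hne
    have h2 : g.inner x v v = 0 := LinearMap.congr_fun hv v
    linarith
  have hsurj : Function.Surjective B :=
    (LinearMap.injective_iff_surjective_of_finrank_eq_finrank
      (Subspace.dual_finrank_eq (K := ℝ) (V := Model m)).symm).1 hinj
  obtain ⟨v, hv⟩ := hsurj L.toLinearMap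
  refine ⟨v, fun w ↦ LinearMap.congr_fun hv w, fun v' hv' ↦ hinj ?_⟩
  rw [hv]
  exact LinearMap.ext hv'

/-- The gradient `∇_g f (x)`: the unique tangent vector with `g(∇_g f, w) = df(w)` for all `w`. -/
def gradient (g : Metric m M) (f : M → ℝ) (x : M) : TangentSpace 𝓘(ℝ, Model m) x :=
  (existsUnique_inner_eq g x (mfderiv 𝓘(ℝ, Model m) 𝓘(ℝ, ℝ) f x)).choose

variable (m) in
/-- Critical points of `f`. -/
def IsCritical (f : M → ℝ) (p : M) : Prop :=
  mfderiv 𝓘(ℝ, Model m) 𝓘(ℝ, ℝ) f p = 0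

variable (m) in
/-- The Hessian matrix `∂²f / ∂xᵢ∂xⱼ` at `p`, as a bilinear form, in the preferred chart at `p`. -/
def hessian (f : M → ℝ) (p : M) : Model m →L[ℝ] Model m →L[ℝ] ℝ :=
  fderiv ℝ (fderiv ℝ (f ∘ (extChartAt 𝓘(ℝ, Model m) p).symm)) (extChartAt 𝓘(ℝ, Model m) p p)

variable (m) in
/-- Morse functions: smooth, with non-degenerate Hessian at every critical point. -/
structure IsMorse (f : M → ℝ) : Prop where
  smooth : ContMDiff 𝓘(ℝ, Model m) 𝓘(ℝ, ℝ) ∞ f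
  nondegenerate : ∀ p, IsCritical m f p → ∀ v, (∀ w, hessian m f p v w = 0) → v = 0

/-- Solutions of the (possibly non-autonomous) negative gradient flow equation
`u'(t) = - ∇_{g(t)} h(t, u(t))`, `t ∈ ℝ`. -/
def IsFlowLine (g : ℝ → Metric m M) (h : ℝ → M → ℝ) (u : ℝ → M) : Prop :=
  ∀ t : ℝ, HasMFDerivAt 𝓘(ℝ, ℝ) 𝓘(ℝ, Model m) u t
    ((1 : ℝ →L[ℝ] ℝ).smulRight (-gradient (g t) (h t) (u t)))

variable (m) in
/-- The space `𝒫^{1,2}_{p,q}` of `W^{1,2}`-paths from `p` to `q`.  Sobolev regularity of a path in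
the closed manifold `M` is tested by composing with all smooth functions `φ : M → ℝ` (equivalently,
with the coordinates of an embedding of `M` in a Euclidean space): `φ ∘ u` is the primitive of an
`L²` function, and it differs from its limits `φ p`, `φ q` by an `L²` function at the two ends. -/
structure IsW12Path (p q : M) (u : ℝ → M) : Prop where
  continuous : Continuous u
  tendsto_atBot : Tendsto u atBot (𝓝 p)
  tendsto_atTop : Tendsto u atTop (𝓝 q)
  weakDeriv : ∀ φ : M → ℝ, ContMDiff 𝓘(ℝ, Model m) 𝓘(ℝ, ℝ) ∞ φ →
    ∃ v : ℝ → ℝ, MemLp v 2 volume ∧ ∀ a b : ℝ, φ (u b) - φ (u a) = ∫ t in a..b, v t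
  memLp_atBot : ∀ φ : M → ℝ, ContMDiff 𝓘(ℝ, Model m) 𝓘(ℝ, ℝ) ∞ φ →
    MemLp (fun t ↦ φ (u t) - φ p) 2 (volume.restrict (Iic 0))
  memLp_atTop : ∀ φ : M → ℝ, ContMDiff 𝓘(ℝ, Model m) 𝓘(ℝ, ℝ) ∞ φ →
    MemLp (fun t ↦ φ (u t) - φ q) 2 (volume.restrict (Ici 0))

variable (m) in
/-- Convergence of a sequence of paths in the topology of `𝒫^{1,2}_{p,q}`: for all smooth
`φ : M → ℝ`, the differences `φ ∘ u_ν - φ ∘ w` tend to `0` in `W^{1,2}(ℝ)`.  (For `W^{1,2}`-paths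
`deriv` is, almost everywhere, the weak derivative.) -/
def TendstoW12 (u : ℕ → ℝ → M) (w : ℝ → M) : Prop :=
  ∀ φ : M → ℝ, ContMDiff 𝓘(ℝ, Model m) 𝓘(ℝ, ℝ) ∞ φ →
    Tendsto (fun ν ↦ eLpNorm (fun t ↦ φ (u ν t) - φ (w t)) 2 volume) atTop (𝓝 0) ∧
    Tendsto (fun ν ↦ eLpNorm (fun t ↦ deriv (fun r ↦ φ (u ν r)) t - deriv (fun r ↦ φ (w r)) t)
      2 volume) atTop (𝓝 0)

variable (m) in
/-- `C^∞_loc`-convergence of curves in `M`: uniform convergence on compact intervals of all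
derivatives, tested by composing with all smooth functions `φ : M → ℝ` (equivalently, with the
coordinates of an embedding of `M` in a Euclidean space). -/
def TendstoCinftyLoc (u : ℕ → ℝ → M) (w : ℝ → M) : Prop :=
  ∀ φ : M → ℝ, ContMDiff 𝓘(ℝ, Model m) 𝓘(ℝ, ℝ) ∞ φ → ∀ k : ℕ,
    TendstoLocallyUniformly (fun ν ↦ iteratedDeriv k (fun t ↦ φ (u ν t)))
      (iteratedDeriv k (fun t ↦ φ (w t))) atTop

/-- `W^{1,2}`-flow lines of `(h, g)` from `p` to `q`. -/
def connecting (g : ℝ → Metric m M) (h : ℝ → M → ℝ) (p q : M) : Set (ℝ → M) :=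
  {u | IsW12Path m p q u ∧ IsFlowLine g h u}

/-- Parametrized flow lines of the time-independent pair `(f, g)` from `p` to `q`: the
representatives of the elements of `ℳ^f_{p,q}`. -/
def connectingAutonomous (g : Metric m M) (f : M → ℝ) (p q : M) : Set (ℝ → M) :=
  connecting (fun _ ↦ g) (fun _ ↦ f) p q

end Basics

/-- The parameter cube `[0,1]^ℓ`. -/
def cube (ℓ : ℕ) : Set (Fin ℓ → ℝ) := Icc 0 1

section Homotopy

variable {m ℓ : ℕ} {M : Type*} [TopologicalSpace M] [ChartedSpace (Model m) M]
  [IsManifold 𝓘(ℝ, Model m) ∞ M]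

/-- `(H, G)` is a finite homotopy with parameters in `[0,1]^ℓ` from `(fα, gα)` to `(fβ, gβ)`:
`H` and `G` are smooth on `[0,1]^ℓ × ℝ × M`, and for some `T > 0` they coincide with `(fα, gα)` for
`t < -T` and with `(fβ, gβ)` for `t > T`.  Only the values at parameters in the cube matter. -/
structure IsHomotopy (fα : M → ℝ) (gα : Metric m M) (fβ : M → ℝ) (gβ : Metric m M)
    (H : (Fin ℓ → ℝ) → ℝ → M → ℝ) (G : (Fin ℓ → ℝ) → ℝ → Metric m M) : Prop where
  smooth_fun : ContMDiffOn (𝓘(ℝ, (Fin ℓ → ℝ) × ℝ).prod 𝓘(ℝ, Model m)) 𝓘(ℝ, ℝ) ∞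
    (fun z : ((Fin ℓ → ℝ) × ℝ) × M ↦ H z.1.1 z.1.2 z.2) ((cube ℓ ×ˢ univ) ×ˢ univ)
  smooth_metric : ContMDiffOn (𝓘(ℝ, (Fin ℓ → ℝ) × ℝ).prod 𝓘(ℝ, Model m))
    (𝓘(ℝ, Model m).prod 𝓘(ℝ, Model m →L[ℝ] Model m →L[ℝ] ℝ)) ∞
    (fun z : ((Fin ℓ → ℝ) × ℝ) × M ↦
      Bundle.TotalSpace.mk' (Model m →L[ℝ] Model m →L[ℝ] ℝ)
        (E := fun x : M ↦ TangentSpace 𝓘(ℝ, Model m) x →L[ℝ]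
          TangentSpace 𝓘(ℝ, Model m) x →L[ℝ] ℝ)
        z.2 ((G z.1.1 z.1.2).inner z.2))
    ((cube ℓ ×ˢ univ) ×ˢ univ)
  finite : ∃ T : ℝ, 0 < T ∧ ∀ s ∈ cube ℓ,
    (∀ t < -T, H s t = fα ∧ G s t = gα) ∧ (∀ t > T, H s t = fβ ∧ G s t = gβ)

/-- The moduli space `ℳ^H_{p,q}` of pairs `(s, u)` with `s ∈ [0,1]^ℓ` and `u ∈ 𝒫^{1,2}_{p,q}` a flow
line of `(H(s, ·, ·), G(s, ·))`. -/
def moduli (H : (Fin ℓ → ℝ) → ℝ → M → ℝ) (G : (Fin ℓ → ℝ) → ℝ → Metric m M) (p q : M) :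
    Set ((Fin ℓ → ℝ) × (ℝ → M)) :=
  {z | z.1 ∈ cube ℓ ∧ z.2 ∈ connecting (G z.1) (H z.1) p q}

/-- The sequence `z` converges in `ℳ^H_{p,q} ⊆ [0,1]^ℓ × 𝒫^{1,2}_{p,q}`. -/
def ConvergesInModuli (H : (Fin ℓ → ℝ) → ℝ → M → ℝ) (G : (Fin ℓ → ℝ) → ℝ → Metric m M) (p q : M)
    (z : ℕ → (Fin ℓ → ℝ) × (ℝ → M)) : Prop :=
  ∃ z₀ ∈ moduli H G p q, Tendsto (fun ν ↦ (z ν).1) atTop (𝓝 z₀.1) ∧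
    TendstoW12 m (fun ν ↦ (z ν).2) z₀.2

/-- Broken flow lines `{u¹, …, (s₀, u^{k₀}), …, uⁿ}`, `n ≥ 2`, from `p` to `q`, with breaking points
`c₀ = p, c₁, …, cₙ = q`.  With the indices of `Fin n` starting at `0`, the piece `u k` runs from
`c k` to `c (k + 1)`.  The trajectories of `fα` and `fβ` are non-constant.  The `H`-trajectory
may be constant: if `(H, G)` is independent of `t`, then the shifts `u(· + ν)` of one flow line
converge in `C^∞_loc` to a constant one. -/
structure BrokenLine (fα : M → ℝ) (gα : Metric m M) (fβ : M → ℝ) (gβ : Metric m M)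
    (H : (Fin ℓ → ℝ) → ℝ → M → ℝ) (G : (Fin ℓ → ℝ) → ℝ → Metric m M) (p q : M) where
  n : ℕ
  two_le : 2 ≤ n
  k₀ : Fin n
  s₀ : Fin ℓ → ℝ
  u : Fin n → ℝ → M
  c : Fin (n + 1) → M
  c_zero : c 0 = p
  c_last : c (Fin.last n) = q
  critical_left : ∀ i : Fin (n + 1), i ≤ k₀.castSucc → IsCritical m fα (c i)
  critical_right : ∀ i : Fin (n + 1), k₀.succ ≤ i → IsCritical m fβ (c i)
  mem_left : ∀ k < k₀, u k ∈ connectingAutonomous gα fα (c k.castSucc) (c k.succ)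
  mem_middle : (s₀, u k₀) ∈ moduli H G (c k₀.castSucc) (c k₀.succ)
  mem_right : ∀ k > k₀, u k ∈ connectingAutonomous gβ fβ (c k.castSucc) (c k.succ)
  nonconstant : ∀ k ≠ k₀, ∀ x : M, u k ≠ fun _ ↦ x

/-- Floer–Gromov convergence of `z ν = (s_ν, u_ν)` to a broken line: `s_ν → s₀`, and there are time
shifts `r k ν`, zero for `k = k₀`, with `u_ν (· + r k ν) → u k` in `C^∞_loc` for every `k`. -/
def FloerGromovTendsto {fα : M → ℝ} {gα : Metric m M} {fβ : M → ℝ} {gβ : Metric m M}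
    {H : (Fin ℓ → ℝ) → ℝ → M → ℝ} {G : (Fin ℓ → ℝ) → ℝ → Metric m M} {p q : M}
    (z : ℕ → (Fin ℓ → ℝ) × (ℝ → M)) (y : BrokenLine fα gα fβ gβ H G p q) : Prop :=
  Tendsto (fun ν ↦ (z ν).1) atTop (𝓝 y.s₀) ∧
  ∃ r : Fin y.n → ℕ → ℝ, (∀ ν, r y.k₀ ν = 0) ∧
    ∀ k, TendstoCinftyLoc m (fun ν t ↦ (z ν).2 (t + r k ν)) (y.u k)

end Homotopy

end HigherMorse

end

open Set Filter Topology MeasureTheory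
open scoped Manifold ContDiff ENNReal

noncomputable section

/-! The field `-∇_G H` is uniformly bounded, because `M` and the cube are compact and `(H, G)` does
not depend on `t` far out. The curves `u_ν` are therefore equi-Lipschitz, and by Arzelà–Ascoli a
subsequence converges locally uniformly to some `w` (`IsHomotopy.exists_subseq_locConv`). Along flow
lines every derivative of `φ ∘ u` is a fixed smooth function of `(s, t, u t)`, so `w` is again a
flow line and the convergence is already `C^∞_loc`.

For `t > T` the curves are gradient lines of `fβ`, and the energy density `|∇f|²` integrates to the
drop of `f`. Since `fβ` is Morse, `w` converges to a critical point `b`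
(`FlowsAfter.exists_tendsto`). Take a closed neighbourhood `V` of `b` containing no other critical
point. Either the `u_ν` stay in `V` from a time independent of `ν` on, and then `b = q`; or
infinitely many leave `V`, at times tending to `∞`, and recentring at the exit times gives a
non-constant `fβ`-line from `b` to a critical point of lower value. Critical points are finite in
number, so the iteration stops (`exists_chain`). The end `-∞` is the same statement for `-fα` and
reversed time.

If neither end breaks, `w` runs from `p` to `q`. Non-degeneracy bounds `(φ - φ q)²` by `C |∇f|²`
near `q` (`IsMorse.exists_sub_sq_le`), so the `L²` tails of `φ ∘ u_ν - φ q` are bounded by the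
energy tails `f (u_ν R) - f q`. These are uniformly small because `f (u_ν R) → f (w R)`, which gives
`W^{1,2}` convergence (`IsHomotopy.tendstoW12`) without exponential decay estimates. Otherwise `w`
and the two chains form the broken line. -/

namespace HigherMorse

/-! ### Smooth dependence of the gradient on parameters. -/

section Gradient

variable {m : ℕ} {M : Type*} [TopologicalSpace M] [ChartedSpace (Model m) M]
  [IsManifold 𝓘(ℝ, Model m) ∞ M]

theorem inner_gradient (g : Metric m M) (f : M → ℝ) (x : M)
    (w : TangentSpace 𝓘(ℝ, Model m) x) :
    g.inner x (gradient g f x) w = mfderiv 𝓘(ℝ, Model m) 𝓘(ℝ, ℝ) f x w :=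
  (existsUnique_inner_eq g x (mfderiv 𝓘(ℝ, Model m) 𝓘(ℝ, ℝ) f x)).choose_spec.1 w

theorem eq_gradient (g : Metric m M) (f : M → ℝ) (x : M) (v : TangentSpace 𝓘(ℝ, Model m) x)
    (h : ∀ w, g.inner x v w = mfderiv 𝓘(ℝ, Model m) 𝓘(ℝ, ℝ) f x w) : v = gradient g f x :=
  (existsUnique_inner_eq g x (mfderiv 𝓘(ℝ, Model m) 𝓘(ℝ, ℝ) f x)).choose_spec.2 v h

theorem neg_gradient (g : Metric m M) (f : M → ℝ) (x : M) :
    -gradient g f x = gradient g (-f) x := by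
  refine eq_gradient g (-f) x _ fun w ↦ ?_
  rw [map_neg]
  have h : mfderiv 𝓘(ℝ, Model m) 𝓘(ℝ, ℝ) (-f) x = -mfderiv 𝓘(ℝ, Model m) 𝓘(ℝ, ℝ) f x :=
    mfderiv_neg
  rw [h]
  exact congrArg Neg.neg (inner_gradient g f x w)

/-- The gradient of a function depending smoothly on parameters, for a metric depending smoothly on
parameters, is smooth. -/
theorem contMDiffOn_gradient {P : Type*} [NormedAddCommGroup P] [NormedSpace ℝ P] {A : Set P}
    {H : P → M → ℝ} {G : P → Metric m M}
    (hH : ContMDiffOn (𝓘(ℝ, P).prod 𝓘(ℝ, Model m)) 𝓘(ℝ, ℝ) ∞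
      (fun z : P × M ↦ H z.1 z.2) (A ×ˢ univ))
    (hG : ContMDiffOn (𝓘(ℝ, P).prod 𝓘(ℝ, Model m))
      (𝓘(ℝ, Model m).prod 𝓘(ℝ, Model m →L[ℝ] Model m →L[ℝ] ℝ)) ∞
      (fun z : P × M ↦
        Bundle.TotalSpace.mk' (Model m →L[ℝ] Model m →L[ℝ] ℝ)
          (E := fun x : M ↦ TangentSpace 𝓘(ℝ, Model m) x →L[ℝ]
            TangentSpace 𝓘(ℝ, Model m) x →L[ℝ] ℝ)
          z.2 ((G z.1).inner z.2))
      (A ×ˢ univ)) :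
    ContMDiffOn (𝓘(ℝ, P).prod 𝓘(ℝ, Model m)) 𝓘(ℝ, Model m).tangent ∞
      (fun z : P × M ↦ (⟨z.2, gradient (G z.1) (H z.1) z.2⟩ : TangentBundle 𝓘(ℝ, Model m) M))
      (A ×ˢ univ) := by
  intro z₀ hz₀
  have hA := (contMDiffWithinAt_hom_bundle _).1 (hG z₀ hz₀)
  have hB : ContMDiffWithinAt (𝓘(ℝ, P).prod 𝓘(ℝ, Model m)) 𝓘(ℝ, Model m →L[ℝ] ℝ) ∞
      (inTangentCoordinates 𝓘(ℝ, Model m) 𝓘(ℝ, ℝ) (fun z : P × M ↦ z.2)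
        (fun z ↦ H z.1 z.2) (fun z ↦ mfderivWithin 𝓘(ℝ, Model m) 𝓘(ℝ, ℝ) (H z.1) univ z.2) z₀)
      (A ×ˢ univ) z₀ := by
    refine ContMDiffWithinAt.mfderivWithin (N := P × M) (f := fun z x ↦ H z.1 x)
      (u := univ) (n := ∞) (m := ∞) ?_ ?_ hz₀ (mapsTo_univ _ _) (by simp) uniqueMDiffOn_univ
    · refine (hH (z₀.1, z₀.2) ⟨hz₀.1, mem_univ _⟩).comp (z₀, z₀.2)
        (f := fun w : (P × M) × M ↦ (w.1.1, w.2)) (t := A ×ˢ univ)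
        ?_ ?_
      · have h : ContMDiff ((𝓘(ℝ, P).prod 𝓘(ℝ, Model m)).prod 𝓘(ℝ, Model m))
            (𝓘(ℝ, P).prod 𝓘(ℝ, Model m)) ∞ (fun w : (P × M) × M ↦ (w.1.1, w.2)) :=
          (contMDiff_fst.comp contMDiff_fst).prodMk contMDiff_snd
        exact h.contMDiffAt.contMDiffWithinAt
      · rintro w hw
        exact ⟨hw.1.1, mem_univ _⟩
    · exact contMDiffWithinAt_snd
  refine Bundle.contMDiffWithinAt_totalSpace.2 ⟨contMDiffWithinAt_snd, ?_⟩
  set e := trivializationAt (Model m) (TangentSpace 𝓘(ℝ, Model m) : M → Type _) z₀.2 with he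
  have hbase : ∀ᶠ z in 𝓝[A ×ˢ univ] z₀, z.2 ∈ e.baseSet := by
    have : Tendsto (fun z : P × M ↦ z.2) (𝓝[A ×ˢ univ] z₀) (𝓝 z₀.2) :=
      (continuous_snd.tendsto _).mono_left nhdsWithin_le_nhds
    exact this (e.open_baseSet.mem_nhds (FiberBundle.mem_baseSet_trivializationAt' z₀.2))
  set a : P × M → Model m →L[ℝ] Model m →L[ℝ] ℝ := fun z ↦ _ with ha
  change _ ∧ ContMDiffWithinAt _ _ _ a _ _ at hA
  set b : P × M → Model m →L[ℝ] ℝ := inTangentCoordinates 𝓘(ℝ, Model m) 𝓘(ℝ, ℝ)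
    (fun z : P × M ↦ z.2) (fun z ↦ H z.1 z.2)
    (fun z ↦ mfderivWithin 𝓘(ℝ, Model m) 𝓘(ℝ, ℝ) (H z.1) univ z.2) z₀ with hb
  have ha_apply : ∀ z : P × M, z.2 ∈ e.baseSet → ∀ v w,
      a z v w = (G z.1).inner z.2 (e.symm z.2 v) (e.symm z.2 w) := by
    intro z hz v w
    rw [ha]
    simp only
    refine (inCoordinates_apply_eq₂ (E₃ := fun _ : M ↦ ℝ) (F₃ := ℝ) hz hz (mem_univ _)).trans ?_
    simp only [Bundle.Trivialization.linearMapAt_apply]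
    simp [he]
  have hb_apply : ∀ z : P × M, z.2 ∈ e.baseSet → ∀ w,
      b z w = mfderiv 𝓘(ℝ, Model m) 𝓘(ℝ, ℝ) (H z.1) z.2 (e.symm z.2 w) := by
    intro z hz w
    simp only [hb, inTangentCoordinates]
    have hy : H z.1 z.2 ∈
        (trivializationAt ℝ (TangentSpace 𝓘(ℝ, ℝ)) (H z₀.1 z₀.2)).baseSet := by
      simp [chartAt_self_eq]
    rw [ContinuousLinearMap.inCoordinates_eq hz hy]
    simp
    rfl
  -- Positive definiteness makes the Gram matrix `a z` injective, and the dimensions agree.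
  have hinv : ∀ z : P × M, z.2 ∈ e.baseSet → (a z).IsInvertible := by
    intro z hz
    have hinj : Function.Injective (a z).toLinearMap := by
      rw [injective_iff_map_eq_zero]
      intro v hv
      have h1 : a z v v = 0 := by
        have : a z v = 0 := hv
        rw [this]; rfl
      rw [ha_apply z hz] at h1
      have h2 : e.symm z.2 v = 0 := by
        by_contra hne
        exact ((G z.1).pos _ _ hne).ne' h1
      have h3 : (e.continuousLinearEquivAt ℝ z.2 hz).symm v = 0 := h2
      exact (e.continuousLinearEquivAt ℝ z.2 hz).symm.map_eq_zero_iff.1 h3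
    let L : Model m ≃ₗ[ℝ] (Model m →L[ℝ] ℝ) :=
      LinearEquiv.ofInjectiveOfFinrankEq (a z).toLinearMap hinj (by
      rw [LinearMap.toContinuousLinearMap.symm.finrank_eq]; simp)
    exact ⟨L.toContinuousLinearEquiv, by ext; rfl⟩
  -- In the trivialization the gradient is `a⁻¹ b`, with `a` the Gram matrix and `b` the
  -- differential of `H`; inversion is smooth at invertible maps.
  have hv : ∀ z : P × M, z.2 ∈ e.baseSet →
      (e ⟨z.2, gradient (G z.1) (H z.1) z.2⟩).2 = (a z).inverse (b z) := by
    intro z hz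
    have h1 : a z (e ⟨z.2, gradient (G z.1) (H z.1) z.2⟩).2 = b z := by
      ext w
      rw [ha_apply z hz, hb_apply z hz, ← inner_gradient (G z.1)]
      congr 2
      exact e.symm_apply_apply_mk hz _
    obtain ⟨L, hL⟩ := hinv z hz
    rw [← h1, ← hL]
    simp
  have hz₀b : z₀.2 ∈ e.baseSet := FiberBundle.mem_baseSet_trivializationAt' z₀.2
  refine ContMDiffWithinAt.congr_of_eventuallyEq (f := fun z ↦ (a z).inverse (b z)) ?_
    (hbase.mono fun z hz ↦ hv z hz) (hv z₀ hz₀b)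
  refine ContMDiffWithinAt.clm_apply ?_ hB
  exact ((hinv z₀ hz₀b).contDiffAt_map_inverse (n := ∞)).contMDiffAt.comp_contMDiffWithinAt z₀ hA.2

end Gradient

/-! ### Time derivatives of flow lines as functions on the domain. -/

section LieDerivative

variable {m ℓ : ℕ} {M : Type*} [TopologicalSpace M] [ChartedSpace (Model m) M]

variable (ℓ M) in
/-- The domain `[0,1]^ℓ × ℝ × M` of a homotopy. -/
def domain : Set (((Fin ℓ → ℝ) × ℝ) × M) := (cube ℓ ×ˢ univ) ×ˢ univ

/-- The cube has a boundary, so derivatives are taken within the domain; uniqueness makes these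
derivatives again smooth and lets them be iterated. -/
theorem uniqueMDiffOn_domain :
    UniqueMDiffOn (𝓘(ℝ, (Fin ℓ → ℝ) × ℝ).prod 𝓘(ℝ, Model m)) (domain ℓ M) := by
  have h : UniqueDiffOn ℝ (cube ℓ) := by
    rw [cube, ← pi_univ_Icc]
    exact UniqueDiffOn.univ_pi fun _ ↦ uniqueDiffOn_Icc zero_lt_one
  exact (h.prod uniqueDiffOn_univ).uniqueMDiffOn.prod uniqueMDiffOn_univ

variable [IsManifold 𝓘(ℝ, Model m) ∞ M]

/-- The derivative of a time-dependent function along the flow of `-∇_G H`. -/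
def lieDeriv (H : (Fin ℓ → ℝ) → ℝ → M → ℝ) (G : (Fin ℓ → ℝ) → ℝ → Metric m M)
    (ψ : ((Fin ℓ → ℝ) × ℝ) × M → ℝ) (z : ((Fin ℓ → ℝ) × ℝ) × M) : ℝ :=
  mfderivWithin (𝓘(ℝ, (Fin ℓ → ℝ) × ℝ).prod 𝓘(ℝ, Model m)) 𝓘(ℝ, ℝ) ψ (domain ℓ M) z
    (((0, 1) : (Fin ℓ → ℝ) × ℝ), -gradient (G z.1.1 z.1.2) (H z.1.1 z.1.2) z.2)

variable {fα fβ : M → ℝ} {gα gβ : Metric m M} {H : (Fin ℓ → ℝ) → ℝ → M → ℝ}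
  {G : (Fin ℓ → ℝ) → ℝ → Metric m M} {ψ : ((Fin ℓ → ℝ) × ℝ) × M → ℝ}

/-- The Lie derivative is the fibre part of the tangent map of `ψ` composed with the smooth vector
field `(0, 1, -∇_G H)` on the domain. -/
theorem contMDiffOn_lieDeriv (hHG : IsHomotopy fα gα fβ gβ H G)
    (hψ : ContMDiffOn (𝓘(ℝ, (Fin ℓ → ℝ) × ℝ).prod 𝓘(ℝ, Model m)) 𝓘(ℝ, ℝ) ∞ ψ (domain ℓ M)) :
    ContMDiffOn (𝓘(ℝ, (Fin ℓ → ℝ) × ℝ).prod 𝓘(ℝ, Model m)) 𝓘(ℝ, ℝ) ∞ (lieDeriv H G ψ)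
      (domain ℓ M) := by
  have hX : ContMDiffOn (𝓘(ℝ, (Fin ℓ → ℝ) × ℝ).prod 𝓘(ℝ, Model m)) 𝓘(ℝ, Model m).tangent ∞
      (fun z : ((Fin ℓ → ℝ) × ℝ) × M ↦ (⟨z.2, -gradient (G z.1.1 z.1.2) (H z.1.1 z.1.2) z.2⟩ :
        TangentBundle 𝓘(ℝ, Model m) M)) (domain ℓ M) := by
    simp_rw [neg_gradient]
    exact contMDiffOn_gradient (P := (Fin ℓ → ℝ) × ℝ) (H := fun p ↦ -H p.1 p.2)
      (G := fun p ↦ G p.1 p.2)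
      hHG.smooth_fun.neg hHG.smooth_metric
  have hT : ContMDiffOn (𝓘(ℝ, (Fin ℓ → ℝ) × ℝ).prod 𝓘(ℝ, Model m))
      𝓘(ℝ, (Fin ℓ → ℝ) × ℝ).tangent ∞
      (fun z : ((Fin ℓ → ℝ) × ℝ) × M ↦ (⟨z.1, ((0, 1) : (Fin ℓ → ℝ) × ℝ)⟩ :
        TangentBundle 𝓘(ℝ, (Fin ℓ → ℝ) × ℝ) ((Fin ℓ → ℝ) × ℝ))) (domain ℓ M) := by
    have h : ContMDiff 𝓘(ℝ, (Fin ℓ → ℝ) × ℝ) 𝓘(ℝ, (Fin ℓ → ℝ) × ℝ).tangent ∞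
        (fun y : (Fin ℓ → ℝ) × ℝ ↦ (⟨y, ((0, 1) : (Fin ℓ → ℝ) × ℝ)⟩ :
          TangentBundle 𝓘(ℝ, (Fin ℓ → ℝ) × ℝ) ((Fin ℓ → ℝ) × ℝ))) :=
      contMDiff_vectorSpace_iff_contDiff.2 contDiff_const
    exact (h.comp contMDiff_fst).contMDiffOn
  have hY : ContMDiffOn (𝓘(ℝ, (Fin ℓ → ℝ) × ℝ).prod 𝓘(ℝ, Model m))
      (𝓘(ℝ, (Fin ℓ → ℝ) × ℝ).prod 𝓘(ℝ, Model m)).tangent ∞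
      (fun z : ((Fin ℓ → ℝ) × ℝ) × M ↦ (⟨z, (((0, 1) : (Fin ℓ → ℝ) × ℝ),
        -gradient (G z.1.1 z.1.2) (H z.1.1 z.1.2) z.2)⟩ :
        TangentBundle (𝓘(ℝ, (Fin ℓ → ℝ) × ℝ).prod 𝓘(ℝ, Model m)) (((Fin ℓ → ℝ) × ℝ) × M)))
      (domain ℓ M) :=
    (contMDiff_equivTangentBundleProd_symm (n := ∞)).comp_contMDiffOn (hT.prodMk hX)
  exact (contMDiff_snd_tangentBundle_modelSpace ℝ 𝓘(ℝ, ℝ)).comp_contMDiffOn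
    ((hψ.contMDiffOn_tangentMapWithin (m := ∞) (by simp) uniqueMDiffOn_domain).comp hY
      fun z hz ↦ hz)

theorem hasDerivAt_along_flow
    (hψ : ContMDiffOn (𝓘(ℝ, (Fin ℓ → ℝ) × ℝ).prod 𝓘(ℝ, Model m)) 𝓘(ℝ, ℝ) ∞ ψ (domain ℓ M))
    {s : Fin ℓ → ℝ} (hs : s ∈ cube ℓ) {u : ℝ → M} {t : ℝ}
    (hu : HasMFDerivAt 𝓘(ℝ, ℝ) 𝓘(ℝ, Model m) u t
      ((1 : ℝ →L[ℝ] ℝ).smulRight (-gradient (G s t) (H s t) (u t)))) :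
    HasDerivAt (fun τ ↦ ψ ((s, τ), u τ)) (lieDeriv H G ψ ((s, t), u t)) t := by
  have hγ₁ : HasMFDerivAt 𝓘(ℝ, ℝ) 𝓘(ℝ, (Fin ℓ → ℝ) × ℝ) (fun τ : ℝ ↦ (s, τ)) t
      ((1 : ℝ →L[ℝ] ℝ).smulRight ((0, 1) : (Fin ℓ → ℝ) × ℝ)) :=
    ((hasDerivAt_const t s).prodMk (hasDerivAt_id t)).hasFDerivAt.hasMFDerivAt
  have hγ := hγ₁.prodMk hu
  have hz : ((s, t), u t) ∈ domain ℓ M := ⟨⟨hs, mem_univ _⟩, mem_univ _⟩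
  have hψ' := ((hψ _ hz).mdifferentiableWithinAt (by simp)).hasMFDerivWithinAt
  have hmaps : univ ⊆ (fun τ ↦ ((s, τ), u τ)) ⁻¹' domain ℓ M :=
    fun τ _ ↦ ⟨⟨hs, mem_univ _⟩, mem_univ _⟩
  have h := HasMFDerivWithinAt.comp (s := univ) t hψ' hγ.hasMFDerivWithinAt hmaps
  rw [hasMFDerivWithinAt_univ, hasMFDerivAt_iff_hasFDerivAt] at h
  rw [hasDerivAt_iff_hasFDerivAt]
  refine HasFDerivAt.congr_fderiv h (ContinuousLinearMap.ext_ring ?_)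
  change mfderivWithin (𝓘(ℝ, (Fin ℓ → ℝ) × ℝ).prod 𝓘(ℝ, Model m)) 𝓘(ℝ, ℝ) ψ (domain ℓ M)
    ((s, t), u t) ((1 : ℝ) • ((0, 1) : (Fin ℓ → ℝ) × ℝ),
      (1 : ℝ) • -gradient (G s t) (H s t) (u t)) =
      (1 : ℝ) • lieDeriv H G ψ ((s, t), u t)
  rw [one_smul, one_smul, one_smul]
  rfl

/-- The `k`-fold derivative of a function along the flow of `-∇_G H`. -/
def flowDeriv (H : (Fin ℓ → ℝ) → ℝ → M → ℝ) (G : (Fin ℓ → ℝ) → ℝ → Metric m M) (φ : M → ℝ)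
    (k : ℕ) : ((Fin ℓ → ℝ) × ℝ) × M → ℝ :=
  (lieDeriv H G)^[k] (fun z ↦ φ z.2)

theorem contMDiffOn_flowDeriv (hHG : IsHomotopy fα gα fβ gβ H G) {φ : M → ℝ}
    (hφ : ContMDiff 𝓘(ℝ, Model m) 𝓘(ℝ, ℝ) ∞ φ) (k : ℕ) :
    ContMDiffOn (𝓘(ℝ, (Fin ℓ → ℝ) × ℝ).prod 𝓘(ℝ, Model m)) 𝓘(ℝ, ℝ) ∞ (flowDeriv H G φ k)
      (domain ℓ M) := by
  induction k with
  | zero => exact (hφ.comp contMDiff_snd).contMDiffOn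
  | succ k ih =>
    rw [flowDeriv, Function.iterate_succ_apply']
    exact contMDiffOn_lieDeriv hHG ih

theorem hasDerivAt_flowDeriv (hHG : IsHomotopy fα gα fβ gβ H G) {φ : M → ℝ}
    (hφ : ContMDiff 𝓘(ℝ, Model m) 𝓘(ℝ, ℝ) ∞ φ) (k : ℕ) {s : Fin ℓ → ℝ} (hs : s ∈ cube ℓ)
    {u : ℝ → M} {t : ℝ} (hu : HasMFDerivAt 𝓘(ℝ, ℝ) 𝓘(ℝ, Model m) u t
      ((1 : ℝ →L[ℝ] ℝ).smulRight (-gradient (G s t) (H s t) (u t)))) :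
    HasDerivAt (fun τ ↦ flowDeriv H G φ k ((s, τ), u τ)) (flowDeriv H G φ (k + 1) ((s, t), u t))
      t := by
  rw [flowDeriv, flowDeriv, Function.iterate_succ_apply']
  exact hasDerivAt_along_flow (contMDiffOn_flowDeriv hHG hφ k) hs hu

/-- This replaces bootstrapping: all derivatives of `φ ∘ u` are fixed continuous functions of `(s,
t, u t)`, so `C⁰_loc` convergence controls every order. The open set `O` serves shifted curves,
which solve the limiting equation only on part of the line. -/
theorem iteratedDeriv_eq_flowDeriv (hHG : IsHomotopy fα gα fβ gβ H G) {φ : M → ℝ}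
    (hφ : ContMDiff 𝓘(ℝ, Model m) 𝓘(ℝ, ℝ) ∞ φ) {s : Fin ℓ → ℝ} (hs : s ∈ cube ℓ)
    {u : ℝ → M} {O : Set ℝ} (hO : IsOpen O)
    (hu : ∀ t ∈ O, HasMFDerivAt 𝓘(ℝ, ℝ) 𝓘(ℝ, Model m) u t
      ((1 : ℝ →L[ℝ] ℝ).smulRight (-gradient (G s t) (H s t) (u t)))) (k : ℕ) :
    ∀ t ∈ O, iteratedDeriv k (fun τ ↦ φ (u τ)) t = flowDeriv H G φ k ((s, t), u t) := by
  induction k with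
  | zero => intro t _; rfl
  | succ k ih =>
    intro t ht
    rw [iteratedDeriv_succ]
    have h : iteratedDeriv k (fun τ ↦ φ (u τ)) =ᶠ[𝓝 t]
        fun τ ↦ flowDeriv H G φ k ((s, τ), u τ) := by
      filter_upwards [hO.mem_nhds ht] with τ hτ using ih τ hτ
    rw [h.deriv_eq]
    exact (hasDerivAt_flowDeriv hHG hφ k hs (hu t ht)).deriv

end LieDerivative

/-! ### Differentiability tested by smooth functions. -/

section Testing

variable {m : ℕ} {M : Type*} [TopologicalSpace M] [T2Space M] [ChartedSpace (Model m) M]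
  [IsManifold 𝓘(ℝ, Model m) ∞ M]

/-- The derivative of a curve is determined by the derivatives of its compositions with smooth
functions. -/
theorem hasMFDerivAt_of_forall_smooth {w : ℝ → M} {t : ℝ} (hw : ContinuousAt w t)
    {v : TangentSpace 𝓘(ℝ, Model m) (w t)}
    (h : ∀ φ : M → ℝ, ContMDiff 𝓘(ℝ, Model m) 𝓘(ℝ, ℝ) ∞ φ →
      HasDerivAt (fun τ ↦ φ (w τ)) (mfderiv 𝓘(ℝ, Model m) 𝓘(ℝ, ℝ) φ (w t) v) t) :
    HasMFDerivAt 𝓘(ℝ, ℝ) 𝓘(ℝ, Model m) w t ((1 : ℝ →L[ℝ] ℝ).smulRight v) := by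
  obtain ⟨χ⟩ : Nonempty (SmoothBumpFunction 𝓘(ℝ, Model m) (w t)) := inferInstance
  -- The cut-off chart coordinates are globally smooth and agree with the chart coordinates near `w
  -- t`, hence are admissible test functions.
  have hφ : ∀ i : Fin m, ContMDiff 𝓘(ℝ, Model m) 𝓘(ℝ, ℝ) ∞
      (fun x ↦ χ x * extChartAt 𝓘(ℝ, Model m) (w t) x i) := by
    intro i
    have h1 : ContMDiffOn 𝓘(ℝ, Model m) 𝓘(ℝ, ℝ) ∞
        (fun x ↦ extChartAt 𝓘(ℝ, Model m) (w t) x i) (chartAt (Model m) (w t)).source :=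
      (EuclideanSpace.proj (𝕜 := ℝ) i).contMDiff.comp_contMDiffOn contMDiffOn_extChartAt
    exact χ.contMDiff_smul h1
  have hχ : ∀ᶠ τ in 𝓝 t, χ (w τ) = 1 := hw.eventually χ.eventuallyEq_one
  have key : HasFDerivAt (fun τ ↦ extChartAt 𝓘(ℝ, Model m) (w t) (w τ))
      ((1 : ℝ →L[ℝ] ℝ).smulRight (v : Model m)) t := by
    rw [← hasFDerivWithinAt_univ, hasFDerivWithinAt_euclidean]
    intro i
    rw [hasFDerivWithinAt_univ]
    have h2 := h _ (hφ i)
    have h3 : HasDerivAt (fun τ ↦ extChartAt 𝓘(ℝ, Model m) (w t) (w τ) i)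
        (mfderiv 𝓘(ℝ, Model m) 𝓘(ℝ, ℝ)
          (fun x ↦ χ x * extChartAt 𝓘(ℝ, Model m) (w t) x i) (w t) v) t := by
      refine h2.congr_of_eventuallyEq ?_
      filter_upwards [hχ] with τ hτ
      simp [hτ]
    have h4 : mfderiv 𝓘(ℝ, Model m) 𝓘(ℝ, ℝ)
        (fun x ↦ χ x * extChartAt 𝓘(ℝ, Model m) (w t) x i) (w t) v =
          (EuclideanSpace.proj i : Model m →L[ℝ] ℝ) v := by
      have h5 : HasMFDerivAt 𝓘(ℝ, Model m) 𝓘(ℝ, ℝ)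
          (fun x ↦ χ x * extChartAt 𝓘(ℝ, Model m) (w t) x i) (w t)
          (EuclideanSpace.proj (𝕜 := ℝ) i : Model m →L[ℝ] ℝ) := by
        refine ⟨(hφ i).continuous.continuousAt, ?_⟩
        refine HasFDerivAt.hasFDerivWithinAt ?_
        refine HasFDerivAt.congr_of_eventuallyEq
          (EuclideanSpace.proj (𝕜 := ℝ) i : Model m →L[ℝ] ℝ).hasFDerivAt ?_
        have h6 : ∀ᶠ y in 𝓝 (extChartAt 𝓘(ℝ, Model m) (w t) (w t)),
            χ ((extChartAt 𝓘(ℝ, Model m) (w t)).symm y) = 1 := by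
          have h0 : ∀ᶠ x in 𝓝 ((extChartAt 𝓘(ℝ, Model m) (w t)).symm
              (extChartAt 𝓘(ℝ, Model m) (w t) (w t))), χ x = 1 := by
            rw [extChartAt_to_inv]
            exact χ.eventuallyEq_one
          exact (continuousAt_extChartAt_symm (I := 𝓘(ℝ, Model m)) (w t)).eventually h0
        filter_upwards [h6, extChartAt_target_mem_nhds (I := 𝓘(ℝ, Model m)) (w t)] with y hy hy'
        have h7 := (extChartAt 𝓘(ℝ, Model m) (w t)).right_inv hy'
        simp only [writtenInExtChartAt, Function.comp_apply, hy, one_mul, h7]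
        rfl
      rw [h5.mfderiv]
      rfl
    rw [h4, hasDerivAt_iff_hasFDerivAt] at h3
    refine h3.congr_fderiv (ContinuousLinearMap.ext_ring ?_)
    exact ((EuclideanSpace.proj i : Model m →L[ℝ] ℝ).map_smul (1 : ℝ) v).symm
  refine ⟨hw, ?_⟩
  exact key.hasFDerivWithinAt

end Testing

/-! ### Continuous convergence and Arzelà–Ascoli. -/

section LocConv

variable {X Y : Type*} [TopologicalSpace X] [TopologicalSpace Y]

/-- Continuous convergence of curves: `u_ν (t_ν) → w t` whenever `t_ν → t`. -/
def LocConv (u : ℕ → ℝ → X) (w : ℝ → X) : Prop :=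
  ∀ t, Tendsto (fun y : ℕ × ℝ ↦ u y.1 y.2) (atTop ×ˢ 𝓝 t) (𝓝 (w t))

namespace LocConv

variable {u : ℕ → ℝ → X} {w : ℝ → X}

theorem subseq (h : LocConv u w) {j : ℕ → ℕ} (hj : StrictMono j) :
    LocConv (fun ν ↦ u (j ν)) w := fun t ↦
  (h t).comp ((hj.tendsto_atTop.comp tendsto_fst).prodMk tendsto_snd)

theorem tendsto (h : LocConv u w) (t : ℝ) : Tendsto (fun ν ↦ u ν t) atTop (𝓝 (w t)) :=
  (h t).comp (tendsto_id.prodMk (tendsto_const_nhds.mono_right le_rfl))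

theorem comp_continuous (h : LocConv u w) {φ : X → Y} (hφ : Continuous φ) :
    LocConv (fun ν t ↦ φ (u ν t)) (fun t ↦ φ (w t)) := fun t ↦
  (hφ.tendsto _).comp (h t)

theorem comp_neg (h : LocConv u w) : LocConv (fun ν t ↦ u ν (-t)) (fun t ↦ w (-t)) := fun t ↦
  (h (-t)).comp (tendsto_fst.prodMk ((continuous_neg.tendsto t).comp tendsto_snd))

theorem eventually_forall_mem (h : LocConv u w) {K : Set ℝ} (hK : IsCompact K) {V : Set X}
    (hV : IsOpen V) (hw : ∀ t ∈ K, w t ∈ V) : ∀ᶠ ν in atTop, ∀ t ∈ K, u ν t ∈ V := by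
  have h1 : ∀ t ∈ K, ∃ O ∈ 𝓝 t, ∀ᶠ ν in atTop, ∀ τ ∈ O, u ν τ ∈ V := by
    intro t ht
    obtain ⟨A, hA, B, hB, hAB⟩ := eventually_prod_iff.1 ((h t).eventually (hV.mem_nhds (hw t ht)))
    exact ⟨{τ | B τ}, hB, hA.mono fun ν hν τ hτ ↦ hAB hν hτ⟩
  choose! O hO hOV using h1
  obtain ⟨F, hKF⟩ := hK.elim_nhds_subcover' (fun t _ ↦ O t) (fun t ht ↦ hO t ht)
  have h2 : ∀ᶠ ν in atTop, ∀ t ∈ F, ∀ τ ∈ O t, u ν τ ∈ V :=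
    (eventually_all_finset F).2 fun t _ ↦ hOV t t.2
  filter_upwards [h2] with ν hν τ hτ
  obtain ⟨t, ht, hτt⟩ := mem_iUnion₂.1 (hKF hτ)
  exact hν t ht τ hτt

theorem tendstoLocallyUniformly {a : ℕ → ℝ → ℝ} {b : ℝ → ℝ} (h : LocConv a b)
    (hb : Continuous b) : TendstoLocallyUniformly a b atTop := by
  rw [tendstoLocallyUniformly_iff_forall_tendsto]
  intro t
  have h1 : Tendsto (fun y : ℕ × ℝ ↦ (b y.2, a y.1 y.2)) (atTop ×ˢ 𝓝 t) (𝓝 (b t, b t)) := by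
    rw [nhds_prod_eq]
    exact ((hb.tendsto t).comp tendsto_snd).prodMk (h t)
  exact h1.mono_right (nhds_le_uniformity _)

end LocConv

/-- A sequence of equi-Lipschitz curves in a compact space has a locally uniformly convergent
subsequence. -/
theorem exists_subseq_locConv [CompactSpace X] {n : ℕ} {e : X → Fin n → ℝ}
    (he : IsClosedEmbedding e) {K : NNReal} {u : ℕ → ℝ → X}
    (hu : ∀ ν, LipschitzWith K (fun t ↦ e (u ν t))) :
    ∃ j : ℕ → ℕ, StrictMono j ∧ ∃ w : ℝ → X, Continuous w ∧ LocConv (fun ν ↦ u (j ν)) w := by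
  -- Both conditions pass to pointwise limits, so `S` is compact by Arzelà–Ascoli; values in `range
  -- e` let the limit be lifted back to `X`.
  let S : Set C(ℝ, Fin n → ℝ) := {f | LipschitzWith K f ∧ ∀ t, f t ∈ range e}
  have hS : IsCompact S := by
    refine ArzelaAscoli.isCompact_of_equicontinuous S ?_ ?_
    · have h1 : ContinuousMap.toFun '' S =
          (univ.pi fun _ ↦ range e) ∩ {f | LipschitzWith K f} := by
        ext f
        constructor
        · rintro ⟨f, hf, rfl⟩
          exact ⟨fun t _ ↦ hf.2 t, hf.1⟩
        · rintro ⟨h1, h2⟩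
          exact ⟨⟨f, h2.continuous⟩, ⟨h2, fun t ↦ h1 t (mem_univ t)⟩, rfl⟩
      rw [h1]
      exact (isCompact_univ_pi fun _ ↦ isCompact_range he.continuous).inter_right
        (isClosed_setOfPred_lipschitzWith K)
    · exact (LipschitzWith.uniformEquicontinuous _ K fun f ↦ f.2.1).equicontinuous
  obtain ⟨f, hf, j, hj, hlim⟩ := hS.tendsto_subseq
    (x := fun ν ↦ (⟨fun t ↦ e (u ν t), (hu ν).continuous⟩ : C(ℝ, Fin n → ℝ)))
    fun ν ↦ ⟨hu ν, fun t ↦ mem_range_self _⟩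
  choose w hw using hf.2
  have hwf : e ∘ w = f := funext hw
  refine ⟨j, hj, w, he.isInducing.continuous_iff.2 (hwf ▸ f.continuous), fun t ↦ ?_⟩
  rw [he.isInducing.tendsto_nhds_iff, hw]
  have h1 := tendstoLocallyUniformly_iff_forall_tendsto.1
    (ContinuousMap.tendsto_iff_tendstoLocallyUniformly.1 hlim) t
  exact ((f.continuous.tendsto t).comp tendsto_snd).congr_uniformity h1

end LocConv

/-! ### Limits of flow lines. -/

section Limit

variable {m ℓ : ℕ} {M : Type*} [TopologicalSpace M] [ChartedSpace (Model m) M]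
  [IsManifold 𝓘(ℝ, Model m) ∞ M] {fα fβ : M → ℝ} {gα gβ : Metric m M}
  {H : (Fin ℓ → ℝ) → ℝ → M → ℝ} {G : (Fin ℓ → ℝ) → ℝ → Metric m M}

/-- Links `flowDeriv` to the flow equation, and shows that at order one the time enters only through
the pair `(H s t, G s t)`. -/
theorem flowDeriv_one {φ : M → ℝ} (hφ : ContMDiff 𝓘(ℝ, Model m) 𝓘(ℝ, ℝ) ∞ φ)
    {z : ((Fin ℓ → ℝ) × ℝ) × M} (hz : z ∈ domain ℓ M) :
    flowDeriv H G φ 1 z = mfderiv 𝓘(ℝ, Model m) 𝓘(ℝ, ℝ) φ z.2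
      (-gradient (G z.1.1 z.1.2) (H z.1.1 z.1.2) z.2) := by
  have h1 : HasMFDerivAt (𝓘(ℝ, (Fin ℓ → ℝ) × ℝ).prod 𝓘(ℝ, Model m)) 𝓘(ℝ, ℝ)
      (fun z : ((Fin ℓ → ℝ) × ℝ) × M ↦ φ z.2) z
      ((mfderiv 𝓘(ℝ, Model m) 𝓘(ℝ, ℝ) φ z.2).comp (ContinuousLinearMap.snd ℝ
        (TangentSpace 𝓘(ℝ, (Fin ℓ → ℝ) × ℝ) z.1) (TangentSpace 𝓘(ℝ, Model m) z.2))) :=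
    HasMFDerivAt.comp z (hφ.mdifferentiableAt (by simp)).hasMFDerivAt (hasMFDerivAt_snd z)
  change mfderivWithin (𝓘(ℝ, (Fin ℓ → ℝ) × ℝ).prod 𝓘(ℝ, Model m)) 𝓘(ℝ, ℝ)
    (fun z : ((Fin ℓ → ℝ) × ℝ) × M ↦ φ z.2) (domain ℓ M) z _ = _
  rw [h1.hasMFDerivWithinAt.mfderivWithin (uniqueMDiffOn_domain z hz)]
  rfl

theorem LocConv.comp_domain {s : ℕ → Fin ℓ → ℝ} {s₀ : Fin ℓ → ℝ} (hs : ∀ ν, s ν ∈ cube ℓ)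
    (hs₀ : s₀ ∈ cube ℓ) (hlim : Tendsto s atTop (𝓝 s₀)) {u : ℕ → ℝ → M} {w : ℝ → M}
    (h : LocConv u w) {ψ : ((Fin ℓ → ℝ) × ℝ) × M → ℝ} (hψ : ContinuousOn ψ (domain ℓ M)) :
    LocConv (fun ν t ↦ ψ ((s ν, t), u ν t)) (fun t ↦ ψ ((s₀, t), w t)) := by
  intro t
  have h1 : Tendsto (fun y : ℕ × ℝ ↦ ((s y.1, y.2), u y.1 y.2)) (atTop ×ˢ 𝓝 t)
      (𝓝[domain ℓ M] ((s₀, t), w t)) := by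
    refine tendsto_nhdsWithin_iff.2 ⟨?_, Eventually.of_forall fun y ↦
      ⟨⟨hs _, mem_univ _⟩, mem_univ _⟩⟩
    exact ((hlim.comp tendsto_fst).prodMk_nhds tendsto_snd).prodMk_nhds (h t)
  exact (hψ _ ⟨⟨hs₀, mem_univ _⟩, mem_univ _⟩).tendsto.comp h1

theorem continuous_comp_domain {s₀ : Fin ℓ → ℝ} (hs₀ : s₀ ∈ cube ℓ) {w : ℝ → M}
    (hw : Continuous w) {ψ : ((Fin ℓ → ℝ) × ℝ) × M → ℝ} (hψ : ContinuousOn ψ (domain ℓ M)) :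
    Continuous (fun t ↦ ψ ((s₀, t), w t)) :=
  hψ.comp_continuous (by fun_prop) fun _ ↦ ⟨⟨hs₀, mem_univ _⟩, mem_univ _⟩

variable [T2Space M]

/-- Locally uniform limits of flow lines are flow lines. -/
theorem LocConv.isFlowLine (hHG : IsHomotopy fα gα fβ gβ H G) {s : ℕ → Fin ℓ → ℝ}
    {s₀ : Fin ℓ → ℝ} (hs : ∀ ν, s ν ∈ cube ℓ) (hs₀ : s₀ ∈ cube ℓ) (hlim : Tendsto s atTop (𝓝 s₀))
    {u : ℕ → ℝ → M} {w : ℝ → M} (hw : Continuous w) (h : LocConv u w)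
    (hu : ∀ t, ∀ᶠ y : ℕ × ℝ in atTop ×ˢ 𝓝 t, HasMFDerivAt 𝓘(ℝ, ℝ) 𝓘(ℝ, Model m) (u y.1) y.2
      ((1 : ℝ →L[ℝ] ℝ).smulRight (-gradient (G (s y.1) y.2) (H (s y.1) y.2) (u y.1 y.2)))) :
    IsFlowLine (G s₀) (H s₀) w := by
  intro t
  refine hasMFDerivAt_of_forall_smooth hw.continuousAt fun φ hφ ↦ ?_
  rw [← flowDeriv_one (H := H) (G := G) (z := ((s₀, t), w t)) hφ
    ⟨⟨hs₀, mem_univ _⟩, mem_univ _⟩]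
  obtain ⟨A, hA, B, hB, hAB⟩ := eventually_prod_iff.1 (hu t)
  obtain ⟨O, hOB, hO, htO⟩ := mem_nhds_iff.1 hB
  have hψ := (contMDiffOn_flowDeriv hHG hφ 1).continuousOn
  -- The derivatives of `φ ∘ u_ν` are `flowDeriv H G φ 1` along `u_ν` and converge locally
  -- uniformly, so limit and derivative may be exchanged.
  refine hasDerivAt_of_tendstoLocallyUniformlyOn (l := atTop) hO
    (((h.comp_domain hs hs₀ hlim hψ).tendstoLocallyUniformly
      (continuous_comp_domain hs₀ hw hψ)).tendstoLocallyUniformlyOn)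
    (hA.mono fun ν hν τ hτ ↦ ?_) (fun τ _ ↦ (h.comp_continuous hφ.continuous).tendsto τ) htO
  exact hasDerivAt_flowDeriv hHG hφ 0 (hs ν) (hAB hν (hOB hτ))

/-- For flow lines, locally uniform convergence implies convergence of all derivatives. -/
theorem LocConv.tendstoCinftyLoc (hHG : IsHomotopy fα gα fβ gβ H G) {s : ℕ → Fin ℓ → ℝ}
    {s₀ : Fin ℓ → ℝ} (hs : ∀ ν, s ν ∈ cube ℓ) (hs₀ : s₀ ∈ cube ℓ) (hlim : Tendsto s atTop (𝓝 s₀))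
    {u : ℕ → ℝ → M} {w : ℝ → M} (hw : Continuous w) (h : LocConv u w)
    (hu : ∀ t, ∀ᶠ y : ℕ × ℝ in atTop ×ˢ 𝓝 t, HasMFDerivAt 𝓘(ℝ, ℝ) 𝓘(ℝ, Model m) (u y.1) y.2
      ((1 : ℝ →L[ℝ] ℝ).smulRight (-gradient (G (s y.1) y.2) (H (s y.1) y.2) (u y.1 y.2)))) :
    TendstoCinftyLoc m u w := by
  intro φ hφ k
  have hflow := h.isFlowLine hHG hs hs₀ hlim hw hu
  have hψ := (contMDiffOn_flowDeriv hHG hφ k).continuousOn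
  have hw' : iteratedDeriv k (fun t ↦ φ (w t)) = fun t ↦ flowDeriv H G φ k ((s₀, t), w t) :=
    funext fun t ↦ iteratedDeriv_eq_flowDeriv hHG hφ hs₀ isOpen_univ (fun t _ ↦ hflow t) k t
      (mem_univ t)
  rw [hw']
  refine LocConv.tendstoLocallyUniformly (fun t ↦ ?_) (continuous_comp_domain hs₀ hw hψ)
  refine (h.comp_domain hs hs₀ hlim hψ t).congr' ?_
  obtain ⟨A, hA, B, hB, hAB⟩ := eventually_prod_iff.1 (hu t)
  obtain ⟨O, hOB, hO, htO⟩ := mem_nhds_iff.1 hB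
  refine eventually_prod_iff.2 ⟨A, hA, (· ∈ O), hO.mem_nhds htO, fun {ν} hν {τ} hτ ↦ ?_⟩
  exact (iteratedDeriv_eq_flowDeriv hHG hφ (hs ν) hO (fun r hr ↦ hAB hν (hOB hr)) k τ hτ).symm

end Limit

/-! ### Energy density and Cauchy–Schwarz estimates. -/

section Energy

variable {m : ℕ} {M : Type*} [TopologicalSpace M] [ChartedSpace (Model m) M]
  [IsManifold 𝓘(ℝ, Model m) ∞ M]

/-- The time-independent homotopy. -/
theorem IsHomotopy.const (ℓ : ℕ) {f : M → ℝ} (hf : ContMDiff 𝓘(ℝ, Model m) 𝓘(ℝ, ℝ) ∞ f)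
    (g : Metric m M) : IsHomotopy (ℓ := ℓ) f g f g (fun _ _ ↦ f) (fun _ _ ↦ g) where
  smooth_fun := (hf.comp contMDiff_snd).contMDiffOn
  smooth_metric := (g.contMDiff.comp contMDiff_snd).contMDiffOn
  finite := ⟨1, one_pos, fun _ _ ↦ ⟨fun _ _ ↦ ⟨rfl, rfl⟩, fun _ _ ↦ ⟨rfl, rfl⟩⟩⟩

theorem zero_mem_cube (ℓ : ℕ) : (0 : Fin ℓ → ℝ) ∈ cube ℓ := ⟨le_rfl, zero_le_one⟩

theorem inner_self_nonneg (g : Metric m M) (x : M) (v : TangentSpace 𝓘(ℝ, Model m) x) :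
    0 ≤ g.inner x v v := by
  by_cases h : v = 0
  · simp [h]
  · exact (g.pos x v h).le

theorem inner_sq_le (g : Metric m M) (x : M) (v w : TangentSpace 𝓘(ℝ, Model m) x) :
    (g.inner x v w) ^ 2 ≤ g.inner x v v * g.inner x w w := by
  let B : LinearMap.BilinForm ℝ (TangentSpace 𝓘(ℝ, Model m) x) :=
    LinearMap.mk₂ ℝ (fun v w ↦ g.inner x v w) (by simp) (by simp) (by simp) (by simp)
  exact B.apply_sq_le_of_symm (fun v ↦ inner_self_nonneg g x v)
    ⟨fun v w ↦ g.symm x v w⟩ v w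

/-- The squared norm of the gradient. -/
def gradSq (g : Metric m M) (f : M → ℝ) (x : M) : ℝ :=
  g.inner x (gradient g f x) (gradient g f x)

theorem gradSq_nonneg (g : Metric m M) (f : M → ℝ) (x : M) : 0 ≤ gradSq g f x :=
  inner_self_nonneg g x _

theorem gradSq_eq_zero_iff (g : Metric m M) (f : M → ℝ) (x : M) :
    gradSq g f x = 0 ↔ IsCritical m f x := by
  constructor
  · intro h
    have h1 : gradient g f x = 0 := by
      by_contra hne
      exact (g.pos x _ hne).ne' h
    refine ContinuousLinearMap.ext fun w ↦ ?_
    rw [← inner_gradient g, h1, map_zero]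
    rfl
  · intro h
    rw [gradSq, inner_gradient]
    rw [IsCritical] at h
    rw [h]
    rfl

/-- `|∇f|²` is minus the derivative of `f` along its own flow, so this is the case of a constant
homotopy over the zero-dimensional cube. -/
theorem contMDiff_gradSq {f : M → ℝ} (hf : ContMDiff 𝓘(ℝ, Model m) 𝓘(ℝ, ℝ) ∞ f)
    (g : Metric m M) : ContMDiff 𝓘(ℝ, Model m) 𝓘(ℝ, ℝ) ∞ (gradSq g f) := by
  have h1 := contMDiffOn_flowDeriv (IsHomotopy.const 0 hf g) hf 1
  have h2 : ContMDiff 𝓘(ℝ, Model m) (𝓘(ℝ, (Fin 0 → ℝ) × ℝ).prod 𝓘(ℝ, Model m)) ∞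
      (fun x : M ↦ (((0, 0) : (Fin 0 → ℝ) × ℝ), x)) := contMDiff_const.prodMk contMDiff_id
  have hdom : ∀ x : M, (((0, 0) : (Fin 0 → ℝ) × ℝ), x) ∈ domain 0 M :=
    fun x ↦ ⟨⟨zero_mem_cube 0, mem_univ _⟩, mem_univ _⟩
  have h3 := (h1.comp_contMDiff h2 hdom).neg
  refine h3.congr fun x ↦ ?_
  have h4 := flowDeriv_one (H := fun _ _ ↦ f) (G := fun _ _ ↦ g) hf (hdom x)
  change gradSq g f x = -flowDeriv _ _ f 1 _
  rw [h4, gradSq, inner_gradient]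
  exact ((neg_neg _).symm.trans (congrArg Neg.neg (map_neg _ _).symm))

theorem hasDerivAt_comp_flow {f φ : M → ℝ} {g : Metric m M}
    (hφ : ContMDiff 𝓘(ℝ, Model m) 𝓘(ℝ, ℝ) ∞ φ) {u : ℝ → M} {t : ℝ}
    (hu : HasMFDerivAt 𝓘(ℝ, ℝ) 𝓘(ℝ, Model m) u t
      ((1 : ℝ →L[ℝ] ℝ).smulRight (-gradient g f (u t)))) :
    HasDerivAt (fun τ ↦ φ (u τ)) (-g.inner (u t) (gradient g φ (u t)) (gradient g f (u t))) t := by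
  have h := HasMFDerivAt.comp t (hφ.mdifferentiableAt (by simp)).hasMFDerivAt hu
  rw [hasMFDerivAt_iff_hasFDerivAt] at h
  rw [hasDerivAt_iff_hasFDerivAt]
  refine HasFDerivAt.congr_fderiv h (ContinuousLinearMap.ext_ring ?_)
  rw [inner_gradient]
  change mfderiv 𝓘(ℝ, Model m) 𝓘(ℝ, ℝ) φ (u t) ((1 : ℝ) • -gradient g f (u t)) =
    (1 : ℝ) • -(mfderiv 𝓘(ℝ, Model m) 𝓘(ℝ, ℝ) φ (u t) (gradient g f (u t)))
  rw [one_smul, one_smul, map_neg]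

/-- Cauchy–Schwarz and compactness: the speed of any test function along the flow is dominated by
the energy density, with a constant independent of the flow line. -/
theorem exists_inner_gradient_sq_le [CompactSpace M] {φ : M → ℝ}
    (hφ : ContMDiff 𝓘(ℝ, Model m) 𝓘(ℝ, ℝ) ∞ φ) (f : M → ℝ) (g : Metric m M) :
    ∃ C : ℝ, 0 ≤ C ∧ ∀ x, (g.inner x (gradient g φ x) (gradient g f x)) ^ 2 ≤ C * gradSq g f x := by
  obtain ⟨C, hC⟩ := isCompact_univ.bddAbove_image (contMDiff_gradSq hφ g).continuous.continuousOn
  refine ⟨max C 0, le_max_right _ _, fun x ↦ (inner_sq_le g x _ _).trans ?_⟩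
  exact mul_le_mul_of_nonneg_right ((hC ⟨x, mem_univ x, rfl⟩).trans (le_max_left _ _))
    (gradSq_nonneg g f x)

end Energy

/-! ### Consequences of non-degeneracy at critical points. -/

section Morse

variable {m : ℕ} {M : Type*} [TopologicalSpace M] [ChartedSpace (Model m) M]
  [IsManifold 𝓘(ℝ, Model m) ∞ M]

/-- The coefficients of `g` in a trivialization are continuous, hence locally bounded. Used to pass
from the Euclidean norm of a differential to the `g`-norm of the gradient. -/
theorem eventually_inner_symm_le (g : Metric m M) (c : M) :
    ∃ C : ℝ, ∀ᶠ x in 𝓝 c, ∀ w : Model m, g.inner x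
      ((trivializationAt (Model m) (TangentSpace 𝓘(ℝ, Model m) : M → Type _) c).symm x w)
      ((trivializationAt (Model m) (TangentSpace 𝓘(ℝ, Model m) : M → Type _) c).symm x w) ≤
        C * ‖w‖ ^ 2 := by
  set e := trivializationAt (Model m) (TangentSpace 𝓘(ℝ, Model m) : M → Type _) c with he
  have hA := ((contMDiffAt_hom_bundle _).1 (g.contMDiff c)).2
  set a : M → Model m →L[ℝ] Model m →L[ℝ] ℝ := fun z ↦ _ with ha
  change ContMDiffAt _ _ _ a _ at hA
  have ha_apply : ∀ x : M, x ∈ e.baseSet → ∀ v w,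
      a x v w = g.inner x (e.symm x v) (e.symm x w) := by
    intro x hx v w
    rw [ha]
    simp only
    refine (inCoordinates_apply_eq₂ (E₃ := fun _ : M ↦ ℝ) (F₃ := ℝ) hx hx (mem_univ _)).trans ?_
    simp only [Bundle.Trivialization.linearMapAt_apply]
    simp [he]
  refine ⟨‖a c‖ + 1, ?_⟩
  have hn : Tendsto (fun x ↦ ‖a x‖) (𝓝 c) (𝓝 ‖a c‖) :=
    (continuous_norm.tendsto (a c)).comp hA.continuousAt.tendsto
  have h1 : ∀ᶠ x in 𝓝 c, ‖a x‖ < ‖a c‖ + 1 := hn.eventually (eventually_lt_nhds (lt_add_one _))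
  filter_upwards [h1, e.open_baseSet.mem_nhds (FiberBundle.mem_baseSet_trivializationAt' c)]
    with x hx hxe w
  rw [← ha_apply x hxe]
  calc a x w w ≤ ‖a x w w‖ := le_abs_self _
    _ ≤ ‖a x‖ * ‖w‖ * ‖w‖ := (a x).le_opNorm₂ w w
    _ ≤ (‖a c‖ + 1) * ‖w‖ ^ 2 := by
      rw [mul_assoc, ← sq]
      gcongr

theorem contDiffAt_comp_extChartAt_symm {φ : M → ℝ}
    (hφ : ContMDiff 𝓘(ℝ, Model m) 𝓘(ℝ, ℝ) ∞ φ) (c : M) {y : Model m}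
    (hy : y ∈ (extChartAt 𝓘(ℝ, Model m) c).target) :
    ContDiffAt ℝ ∞ (φ ∘ (extChartAt 𝓘(ℝ, Model m) c).symm) y := by
  refine ContMDiffAt.contDiffAt (hφ.contMDiffAt.comp y ?_)
  exact (contMDiffOn_extChartAt_symm c).contMDiffAt ((isOpen_extChartAt_target c).mem_nhds hy)

/-- Near a critical point of a Morse function, the gradient controls the distance. -/
theorem IsMorse.eventually_norm_sq_le {f : M → ℝ} (hf : IsMorse m f) (g : Metric m M) {c : M}
    (hc : IsCritical m f c) :
    ∃ C : ℝ, ∀ᶠ x in 𝓝 c,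
      ‖extChartAt 𝓘(ℝ, Model m) c x - extChartAt 𝓘(ℝ, Model m) c c‖ ^ 2 ≤ C * gradSq g f x := by
  set ξ := extChartAt 𝓘(ℝ, Model m) c with hξ
  set F := f ∘ ξ.symm with hF
  have hy₀ : ξ c ∈ ξ.target := mem_extChartAt_target c
  have hF₀ : fderiv ℝ F (ξ c) = 0 := by
    have h1 : mfderiv 𝓘(ℝ, Model m) 𝓘(ℝ, ℝ) f c = 0 := hc
    have h2 : mfderiv 𝓘(ℝ, Model m) 𝓘(ℝ, ℝ) f c =
        fderivWithin ℝ F (range 𝓘(ℝ, Model m)) (ξ c) :=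
      (hf.smooth.mdifferentiableAt (by simp)).mfderiv
    rw [ModelWithCorners.range_eq_univ, fderivWithin_univ] at h2
    exact h2.symm.trans h1
  have hF₁ : HasFDerivAt (fderiv ℝ F) (hessian m f c) (ξ c) := by
    have h1 : ContDiffAt ℝ 1 (fderiv ℝ F) (ξ c) :=
      (contDiffAt_comp_extChartAt_symm hf.smooth c hy₀).fderiv_right (by norm_cast)
    exact (h1.differentiableAt (by simp)).hasFDerivAt
  have hker : (hessian m f c).toLinearMap.ker = ⊥ := by
    rw [LinearMap.ker_eq_bot']
    intro v hv
    refine hf.nondegenerate c hc v fun w ↦ ?_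
    have : hessian m f c v = 0 := hv
    rw [this]
    rfl
  -- An injective linear map in finite dimension is bounded below, so a map whose derivative is the
  -- Hessian, here `fderiv ℝ F`, grows at least linearly away from its zero `ξ c`.
  have hO := (hF₁.isTheta_sub
    (LinearMap.isClosedEmbedding_of_injective hker).isInducing).isBigO_symm
  simp only [hF₀, sub_zero] at hO
  obtain ⟨C₁, hC₁⟩ := hO.bound
  obtain ⟨C₂, hC₂⟩ := eventually_inner_symm_le g c
  refine ⟨C₁ ^ 2 * max C₂ 0, ?_⟩
  filter_upwards [(continuousAt_extChartAt (I := 𝓘(ℝ, Model m)) c).eventually hC₁, hC₂,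
    extChartAt_source_mem_nhds (I := 𝓘(ℝ, Model m)) c] with x h1 h2 hx
  have hρ := gradSq_nonneg g f x
  -- Cauchy–Schwarz for `g`: `|dF(w)| = |g(∇f, v)| ≤ |∇f| |v|`, where `v` is the tangent vector with
  -- coordinates `w`, and `|v|² ≤ C₂ ‖w‖²`.
  have h3 : ‖fderiv ℝ F (ξ x)‖ ≤ √(max C₂ 0 * gradSq g f x) := by
    refine ContinuousLinearMap.opNorm_le_bound _ (Real.sqrt_nonneg _) fun w ↦ ?_
    set v : TangentSpace 𝓘(ℝ, Model m) x :=
      (trivializationAt (Model m) (TangentSpace 𝓘(ℝ, Model m) : M → Type _) c).symm x w with hv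
    have h4 : fderiv ℝ F (ξ x) w = mfderiv 𝓘(ℝ, Model m) 𝓘(ℝ, ℝ) f x v := by
      have h5 : MDifferentiableAt 𝓘(ℝ, Model m) 𝓘(ℝ, Model m) ξ.symm (ξ x) :=
        ((contMDiffOn_extChartAt_symm (n := ∞) c).contMDiffAt
          ((isOpen_extChartAt_target c).mem_nhds (ξ.map_source hx))).mdifferentiableAt (by simp)
      have h6 := mfderiv_comp_of_eq
        (hf.smooth.mdifferentiableAt (x := x) (by simp)) h5 (ξ.left_inv hx)
      have h7 := TangentBundle.symmL_trivializationAt (I := 𝓘(ℝ, Model m)) (x₀ := c) (x := x)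
        (by simpa [hξ] using hx)
      rw [ModelWithCorners.range_eq_univ, mfderivWithin_univ] at h7
      have h8 : v = mfderiv 𝓘(ℝ, Model m) 𝓘(ℝ, Model m) ξ.symm (ξ x) w := by
        have hb : x ∈ (trivializationAt (Model m)
            (TangentSpace 𝓘(ℝ, Model m) : M → Type _) c).baseSet := by simpa [hξ] using hx
        exact (Bundle.Trivialization.symmL_apply _ hb w).symm.trans
          (congrArg (fun L : Model m →L[ℝ] Model m ↦ L w) h7)
      let D : M → Model m →L[ℝ] ℝ := fun y ↦ mfderiv 𝓘(ℝ, Model m) 𝓘(ℝ, ℝ) f y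
      have h9 : D (ξ.symm (ξ x)) = D x := congrArg D (ξ.left_inv hx)
      rw [← mfderiv_eq_fderiv, h8]
      exact (congrArg (fun L : Model m →L[ℝ] ℝ ↦ L w) h6).trans
        (congrArg (fun L : Model m →L[ℝ] ℝ ↦
          L (mfderiv 𝓘(ℝ, Model m) 𝓘(ℝ, Model m) ξ.symm (ξ x) w)) h9)
    rw [h4, ← inner_gradient g, Real.norm_eq_abs, ← Real.sqrt_sq_eq_abs,
      ← Real.sqrt_sq (norm_nonneg w), ← Real.sqrt_mul (by positivity)]
    refine Real.sqrt_le_sqrt ((inner_sq_le g _ _ _).trans ?_)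
    have := (h2 w).trans (mul_le_mul_of_nonneg_right (le_max_left C₂ 0) (sq_nonneg ‖w‖))
    calc _ ≤ gradSq g f x * (max C₂ 0 * ‖w‖ ^ 2) := mul_le_mul_of_nonneg_left this hρ
      _ = _ := by ring
  calc ‖ξ x - ξ c‖ ^ 2 ≤ (C₁ * ‖fderiv ℝ F (ξ x)‖) ^ 2 := by gcongr
    _ = C₁ ^ 2 * ‖fderiv ℝ F (ξ x)‖ ^ 2 := by ring
    _ ≤ C₁ ^ 2 * √(max C₂ 0 * gradSq g f x) ^ 2 := by gcongr
    _ = C₁ ^ 2 * max C₂ 0 * gradSq g f x := by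
      rw [Real.sq_sqrt (by positivity)]
      ring

/-- In the chart, `φ - φ c` is at most linear in the distance to `c`, and the gradient of a Morse
function controls that distance. -/
theorem IsMorse.eventually_sub_sq_le {f : M → ℝ} (hf : IsMorse m f) (g : Metric m M) {c : M}
    (hc : IsCritical m f c) {φ : M → ℝ} (hφ : ContMDiff 𝓘(ℝ, Model m) 𝓘(ℝ, ℝ) ∞ φ) :
    ∃ C : ℝ, ∀ᶠ x in 𝓝 c, (φ x - φ c) ^ 2 ≤ C * gradSq g f x := by
  obtain ⟨C₁, hC₁⟩ := hf.eventually_norm_sq_le g hc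
  obtain ⟨C₂, hC₂⟩ := ((contDiffAt_comp_extChartAt_symm hφ c
    (mem_extChartAt_target c)).differentiableAt (by simp)).hasFDerivAt.isBigO_sub.bound
  refine ⟨C₂ ^ 2 * C₁, ?_⟩
  filter_upwards [hC₁, (continuousAt_extChartAt (I := 𝓘(ℝ, Model m)) c).eventually hC₂,
    extChartAt_source_mem_nhds (I := 𝓘(ℝ, Model m)) c] with x h1 h2 hx
  rw [Function.comp_apply, Function.comp_apply, (extChartAt 𝓘(ℝ, Model m) c).left_inv hx,
    extChartAt_to_inv, Real.norm_eq_abs] at h2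
  rw [← sq_abs]
  calc _ ≤ (C₂ * ‖extChartAt 𝓘(ℝ, Model m) c x - extChartAt 𝓘(ℝ, Model m) c c‖) ^ 2 := by gcongr
    _ = C₂ ^ 2 * ‖extChartAt 𝓘(ℝ, Model m) c x - extChartAt 𝓘(ℝ, Model m) c c‖ ^ 2 := by ring
    _ ≤ C₂ ^ 2 * (C₁ * gradSq g f x) := by gcongr
    _ = _ := by ring

theorem IsMorse.eventually_eq_of_isCritical [Nonempty (Metric m M)] {f : M → ℝ}
    (hf : IsMorse m f) {c : M}
    (hc : IsCritical m f c) : ∀ᶠ x in 𝓝 c, IsCritical m f x → x = c := by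
  obtain ⟨g⟩ := ‹Nonempty (Metric m M)›
  obtain ⟨C₁, hC₁⟩ := hf.eventually_norm_sq_le g hc
  filter_upwards [hC₁, extChartAt_source_mem_nhds (I := 𝓘(ℝ, Model m)) c] with x hx hxs hcrit
  rw [(gradSq_eq_zero_iff g f x).2 hcrit, mul_zero] at hx
  have h1 : extChartAt 𝓘(ℝ, Model m) c x = extChartAt 𝓘(ℝ, Model m) c c := by
    rw [← sub_eq_zero, ← norm_eq_zero]
    exact pow_eq_zero_iff (two_ne_zero) |>.1 (le_antisymm hx (sq_nonneg _))
  exact (extChartAt 𝓘(ℝ, Model m) c).injOn hxs (mem_extChartAt_source c) h1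

theorem isClosed_setOf_isCritical {f : M → ℝ} (hf : ContMDiff 𝓘(ℝ, Model m) 𝓘(ℝ, ℝ) ∞ f)
    (g : Metric m M) : IsClosed {x | IsCritical m f x} := by
  simp_rw [← gradSq_eq_zero_iff g f]
  exact isClosed_eq (contMDiff_gradSq hf g).continuous continuous_const

theorem IsMorse.finite_critical [CompactSpace M] {f : M → ℝ} (hf : IsMorse m f) (g : Metric m M) :
    {x | IsCritical m f x}.Finite := by
  have hcl := isClosed_setOf_isCritical hf.smooth g
  have : Nonempty (Metric m M) := ⟨g⟩
  by_contra hinf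
  obtain ⟨c, -, hc⟩ := Set.Infinite.exists_accPt_of_subset_isCompact hinf isCompact_univ
    (subset_univ _)
  have h1 : IsCritical m f c := hcl.closure_subset (mem_closure_iff_clusterPt.2 hc.clusterPt)
  have h2 := (accPt_iff_frequently.1 hc).and_eventually (hf.eventually_eq_of_isCritical h1)
  obtain ⟨x, hx, hx'⟩ := h2.exists
  exact hx.1 (hx' hx.2)

/-- An isolating neighbourhood of a critical point. -/
structure IsIsolating (f : M → ℝ) (c : M) (V : Set M) : Prop where
  mem_nhds : V ∈ 𝓝 c
  isClosed : IsClosed V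
  eq_of_isCritical : ∀ x ∈ V, IsCritical m f x → x = c

theorem IsMorse.exists_isIsolating [T2Space M] [CompactSpace M] {f : M → ℝ} (hf : IsMorse m f)
    (g : Metric m M) {c : M} (hc : IsCritical m f c) {U : Set M} (hU : U ∈ 𝓝 c) :
    ∃ V ⊆ U, IsIsolating (m := m) f c V := by
  have : Nonempty (Metric m M) := ⟨g⟩
  obtain ⟨V, hV, hVc, hVU⟩ := exists_mem_nhds_isClosed_subset
    (inter_mem hU (hf.eventually_eq_of_isCritical hc))
  exact ⟨V, fun x hx ↦ (hVU hx).1, hV, hVc, fun x hx ↦ (hVU hx).2⟩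

/-- On a compact set without critical points, the gradient is bounded away from zero. -/
theorem exists_le_gradSq {f : M → ℝ} (hf : ContMDiff 𝓘(ℝ, Model m) 𝓘(ℝ, ℝ) ∞ f) (g : Metric m M)
    {K : Set M} (hK : IsCompact K) (hcrit : ∀ x ∈ K, ¬ IsCritical m f x) :
    ∃ δ > 0, ∀ x ∈ K, δ ≤ gradSq g f x := by
  obtain ⟨δ, hδ, h⟩ := hK.exists_forall_le' (contMDiff_gradSq hf g).continuous.continuousOn
    (a := 0) fun x hx ↦ lt_of_le_of_ne (gradSq_nonneg g f x)
      fun h ↦ hcrit x hx ((gradSq_eq_zero_iff g f x).1 h.symm)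
  exact ⟨δ, hδ, h⟩

/-- Near `c` this is the local estimate; on the rest of `V` the gradient is bounded below and `φ` is
bounded. One constant thus serves every curve that stays in `V`. -/
theorem IsMorse.exists_sub_sq_le [CompactSpace M] {f : M → ℝ} (hf : IsMorse m f)
    (g : Metric m M) {c : M} (hc : IsCritical m f c) {V : Set M} (hV : IsIsolating (m := m) f c V)
    {φ : M → ℝ} (hφ : ContMDiff 𝓘(ℝ, Model m) 𝓘(ℝ, ℝ) ∞ φ) :
    ∃ C : ℝ, 0 ≤ C ∧ ∀ x ∈ V, (φ x - φ c) ^ 2 ≤ C * gradSq g f x := by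
  obtain ⟨C₁, hC₁⟩ := hf.eventually_sub_sq_le g hc hφ
  obtain ⟨U, hU, hUo, hcU⟩ := mem_nhds_iff.1 hC₁
  obtain ⟨δ, hδ, hδ'⟩ := exists_le_gradSq hf.smooth g (K := V \ U) (hV.isClosed.isCompact.diff hUo)
    fun x hx h ↦ hx.2 (hV.eq_of_isCritical x hx.1 h ▸ hcU)
  obtain ⟨B, hB⟩ := isCompact_univ.bddAbove_image
    (f := fun x ↦ (φ x - φ c) ^ 2) ((hφ.continuous.sub continuous_const).pow 2).continuousOn
  refine ⟨max (max C₁ 0) (max B 0 / δ), (le_max_right C₁ 0).trans (le_max_left _ _),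
    fun x hx ↦ ?_⟩
  have hρ := gradSq_nonneg g f x
  by_cases hxU : x ∈ U
  · refine (hU hxU : _ ≤ _).trans (mul_le_mul_of_nonneg_right ?_ hρ)
    exact (le_max_left _ _).trans (le_max_left _ _)
  · have h1 := hδ' x ⟨hx, hxU⟩
    calc (φ x - φ c) ^ 2 ≤ max B 0 := (hB ⟨x, mem_univ x, rfl⟩).trans (le_max_left _ _)
      _ = max B 0 / δ * δ := by field_simp
      _ ≤ max B 0 / δ * gradSq g f x := by gcongr
      _ ≤ _ := by gcongr; exact le_max_right _ _

end Morse

/-! ### Asymptotics of gradient lines on a half-line. -/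

section HalfLine

variable {m : ℕ} {M : Type*} [TopologicalSpace M] [ChartedSpace (Model m) M]
  [IsManifold 𝓘(ℝ, Model m) ∞ M]

/-- The curve `u` solves `u' = -∇_g f (u)` on the half-line `(T, ∞)`. -/
def FlowsAfter (g : Metric m M) (f : M → ℝ) (T : ℝ) (u : ℝ → M) : Prop :=
  ∀ t > T, HasMFDerivAt 𝓘(ℝ, ℝ) 𝓘(ℝ, Model m) u t
    ((1 : ℝ →L[ℝ] ℝ).smulRight (-gradient g f (u t)))

variable {f : M → ℝ} {g : Metric m M} {T : ℝ} {u : ℝ → M}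

theorem FlowsAfter.mono (hu : FlowsAfter g f T u) {R : ℝ} (hR : T ≤ R) :
    FlowsAfter g f R u := fun t ht ↦ hu t (hR.trans_lt ht)

theorem FlowsAfter.hasDerivAt (hf : ContMDiff 𝓘(ℝ, Model m) 𝓘(ℝ, ℝ) ∞ f)
    (hu : FlowsAfter g f T u) {t : ℝ} (ht : T < t) :
    HasDerivAt (fun τ ↦ f (u τ)) (-gradSq g f (u t)) t :=
  hasDerivAt_comp_flow hf (hu t ht)

theorem FlowsAfter.antitoneOn (hf : ContMDiff 𝓘(ℝ, Model m) 𝓘(ℝ, ℝ) ∞ f)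
    (hu : FlowsAfter g f T u) (hc : Continuous u) : AntitoneOn (fun t ↦ f (u t)) (Ici T) := by
  refine antitoneOn_of_deriv_nonpos (convex_Ici T) (hf.continuous.comp hc).continuousOn ?_ ?_
  · rw [interior_Ici]
    exact fun t ht ↦ (hu.hasDerivAt hf ht).differentiableAt.differentiableWithinAt
  · rw [interior_Ici]
    intro t ht
    rw [(hu.hasDerivAt hf ht).deriv]
    exact neg_nonpos.2 (gradSq_nonneg g f _)

/-- Energy identity: the tail energy depends only on the value of `f` at the starting time and at
the limit point. -/
theorem FlowsAfter.integral_gradSq (hf : ContMDiff 𝓘(ℝ, Model m) 𝓘(ℝ, ℝ) ∞ f)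
    (hu : FlowsAfter g f T u) (hc : Continuous u) {c : M} (hlim : Tendsto u atTop (𝓝 c)) :
    ∫ t in Ioi T, gradSq g f (u t) = f (u T) - f c := by
  have := integral_Ioi_of_hasDerivAt_of_nonpos (a := T)
    (hf.continuous.comp hc).continuousWithinAt (fun t ht ↦ hu.hasDerivAt hf ht)
    (fun t _ ↦ neg_nonpos.2 (gradSq_nonneg g f _)) ((hf.continuous.tendsto c).comp hlim)
  rw [integral_neg] at this
  simp only [Function.comp_apply] at this
  linarith

variable [CompactSpace M]

theorem FlowsAfter.exists_tendsto_value (hf : ContMDiff 𝓘(ℝ, Model m) 𝓘(ℝ, ℝ) ∞ f)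
    (hu : FlowsAfter g f T u) (hc : Continuous u) :
    ∃ l, Tendsto (fun t ↦ f (u t)) atTop (𝓝 l) := by
  have h1 : Antitone (fun t ↦ f (u (max t T))) := fun a b hab ↦
    hu.antitoneOn hf hc (mem_Ici.2 (le_max_right a T)) (mem_Ici.2 (le_max_right b T))
      (max_le_max_right T hab)
  have h2 : BddBelow (range fun t ↦ f (u (max t T))) := by
    refine (isCompact_range hf.continuous).bddBelow.mono ?_
    rintro _ ⟨t, rfl⟩
    exact mem_range_self _
  refine ⟨_, (tendsto_atTop_ciInf h1 h2).congr' ?_⟩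
  filter_upwards [eventually_ge_atTop T] with t ht
  rw [max_eq_left ht]

theorem FlowsAfter.integrableOn_gradSq (hf : ContMDiff 𝓘(ℝ, Model m) 𝓘(ℝ, ℝ) ∞ f)
    (hu : FlowsAfter g f T u) (hc : Continuous u) :
    IntegrableOn (fun t ↦ gradSq g f (u t)) (Ioi T) := by
  obtain ⟨l, hl⟩ := hu.exists_tendsto_value hf hc
  have := integrableOn_Ioi_deriv_of_nonpos (a := T)
    (hf.continuous.comp hc).continuousWithinAt (fun t ht ↦ hu.hasDerivAt hf ht)
    (fun t _ ↦ neg_nonpos.2 (gradSq_nonneg g f _)) hl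
  simpa using this.neg

theorem exists_sq_deriv_le {φ : M → ℝ} (hφ : ContMDiff 𝓘(ℝ, Model m) 𝓘(ℝ, ℝ) ∞ φ) (f : M → ℝ)
    (g : Metric m M) : ∃ C : ℝ, 0 ≤ C ∧ ∀ (u : ℝ → M) (t : ℝ),
      HasMFDerivAt 𝓘(ℝ, ℝ) 𝓘(ℝ, Model m) u t
        ((1 : ℝ →L[ℝ] ℝ).smulRight (-gradient g f (u t))) →
      (deriv (fun τ ↦ φ (u τ)) t) ^ 2 ≤ C * gradSq g f (u t) := by
  obtain ⟨C, hC, h⟩ := exists_inner_gradient_sq_le hφ f g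
  refine ⟨C, hC, fun u t hu ↦ ?_⟩
  rw [(hasDerivAt_comp_flow hφ hu).deriv, neg_sq]
  exact h _

/-- Write `ρ` for the energy density along `u`. It is integrable and `ρ'` is bounded, so both `ρ²`
and its derivative `2ρρ'` are integrable, which forces `ρ² → 0`. The square is what makes the
derivative integrable. -/
theorem FlowsAfter.tendsto_gradSq (hf : ContMDiff 𝓘(ℝ, Model m) 𝓘(ℝ, ℝ) ∞ f)
    (hu : FlowsAfter g f T u) (hc : Continuous u) :
    Tendsto (fun t ↦ gradSq g f (u t)) atTop (𝓝 0) := by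
  have hρ := contMDiff_gradSq hf g
  have hintegrable := hu.integrableOn_gradSq hf hc
  obtain ⟨B, hB⟩ := isCompact_univ.bddAbove_image hρ.continuous.continuousOn
  have hB' : ∀ x, gradSq g f x ≤ B := fun x ↦ hB ⟨x, mem_univ x, rfl⟩
  obtain ⟨C, hC, hder⟩ := exists_sq_deriv_le hρ f g
  have hB0 : 0 ≤ B := (gradSq_nonneg g f (u 0)).trans (hB' _)
  have hd : ∀ t ∈ Ioi T, HasDerivAt (fun t ↦ gradSq g f (u t) ^ 2)
      (2 * gradSq g f (u t) * deriv (fun t ↦ gradSq g f (u t)) t) t := by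
    intro t ht
    have h1 := (hasDerivAt_comp_flow hρ (hu t ht)).differentiableAt.hasDerivAt
    refine (h1.pow 2).congr_deriv ?_
    simp
  have h1 : Tendsto (fun t ↦ gradSq g f (u t) ^ 2) atTop (𝓝 0) := by
    refine tendsto_zero_of_hasDerivAt_of_integrableOn_Ioi hd ?_ ?_
    · refine Integrable.mono' (hintegrable.const_mul (2 * √(C * B))) ?_ ?_
      · exact ((((hρ.continuous.comp hc).measurable.const_mul 2).mul
          (measurable_deriv _)).aestronglyMeasurable)
      · refine (ae_restrict_mem measurableSet_Ioi).mono fun t ht ↦ ?_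
        have h2 : |deriv (fun t ↦ gradSq g f (u t)) t| ≤ √(C * B) :=
          Real.abs_le_sqrt ((hder u t (hu t ht)).trans (mul_le_mul_of_nonneg_left (hB' _) hC))
        rw [Real.norm_eq_abs, abs_mul, abs_mul, abs_two, abs_of_nonneg (gradSq_nonneg g f _)]
        have := gradSq_nonneg g f (u t)
        calc 2 * gradSq g f (u t) * |deriv (fun t ↦ gradSq g f (u t)) t|
            ≤ 2 * gradSq g f (u t) * √(C * B) := by gcongr
          _ = _ := by ring
    · refine Integrable.mono' (hintegrable.const_mul B) ?_ ?_
      · exact ((hρ.continuous.comp hc).pow 2).aestronglyMeasurable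
      · refine Eventually.of_forall fun t ↦ ?_
        rw [Real.norm_eq_abs, abs_of_nonneg (sq_nonneg _), sq]
        exact mul_le_mul_of_nonneg_right (hB' _) (gradSq_nonneg g f _)
  have h3 := (Real.continuous_sqrt.tendsto 0).comp h1
  rw [Real.sqrt_zero] at h3
  exact h3.congr fun t ↦ Real.sqrt_sq (gradSq_nonneg g f _)

/-- Half-infinite flow lines of a Morse function converge to critical points. -/
theorem FlowsAfter.exists_tendsto [T2Space M] (hf : IsMorse m f) (hu : FlowsAfter g f T u)
    (hc : Continuous u) : ∃ c, IsCritical m f c ∧ Tendsto u atTop (𝓝 c) := by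
  have hρ := hu.tendsto_gradSq hf.smooth hc
  obtain ⟨c, hcl⟩ := exists_clusterPt_of_compactSpace (map u atTop)
  have hcl' : MapClusterPt c atTop u := hcl
  have hcrit : IsCritical m f c := by
    rw [← gradSq_eq_zero_iff g]
    by_contra hne
    have hpos := lt_of_le_of_ne (gradSq_nonneg g f c) (Ne.symm hne)
    have h1 := hcl'.frequently ((contMDiff_gradSq hf.smooth g).continuous.continuousAt.eventually
      (eventually_gt_nhds (half_lt_self hpos)))
    obtain ⟨t, h2, h3⟩ :=
      (h1.and_eventually (hρ.eventually (eventually_lt_nhds (half_pos hpos)))).exists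
    exact lt_asymm h2 h3
  refine ⟨c, hcrit, fun U hU ↦ ?_⟩
  obtain ⟨V, hVU, hV⟩ := hf.exists_isIsolating g hcrit hU
  -- To leave `V` the curve would have to cross `V \ interior V`, where the energy density is at
  -- least `δ`; it eventually stays below `δ`.
  obtain ⟨δ, hδ, hδ'⟩ := exists_le_gradSq hf.smooth g (K := V \ interior V)
    (hV.isClosed.isCompact.diff isOpen_interior) fun x hx h ↦ hx.2
      (hV.eq_of_isCritical x hx.1 h ▸ mem_interior_iff_mem_nhds.2 hV.mem_nhds)
  obtain ⟨R, hR⟩ := eventually_atTop.1 (hρ.eventually (eventually_lt_nhds hδ))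
  have hfreq := (hcl'.frequently (interior_mem_nhds.2 hV.mem_nhds)).and_eventually
    (eventually_ge_atTop R)
  obtain ⟨t, ht, htR⟩ := hfreq.exists
  have hsub : u '' Ici R ⊆ interior V := by
    refine IsPreconnected.subset_left_of_subset_union isOpen_interior hV.isClosed.isOpen_compl
      (disjoint_compl_right.mono_left interior_subset) ?_ ⟨u t, ⟨t, htR, rfl⟩, ht⟩
      (isPreconnected_Ici.image u hc.continuousOn)
    rintro _ ⟨τ, hτ, rfl⟩
    by_contra hn
    simp only [mem_union, mem_compl_iff, not_or, not_not] at hn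
    exact absurd (hR τ hτ) (not_lt.2 (hδ' _ ⟨hn.2, hn.1⟩))
  refine mem_map.2 ((eventually_ge_atTop R).mono fun τ hτ ↦ ?_)
  exact hVU (interior_subset (hsub ⟨τ, hτ, rfl⟩))

end HalfLine

/-! ### Square-integrability and `L²` convergence on half-lines. -/

theorem eLpNorm_two_eq_rpow_lintegral_sq (b : ℝ → ℝ) (μ : Measure ℝ) :
    eLpNorm b 2 μ = (∫⁻ t, ENNReal.ofReal (b t ^ 2) ∂μ) ^ (1 / 2 : ℝ) := by
  rw [eLpNorm_eq_lintegral_rpow_enorm_toReal two_ne_zero ENNReal.ofNat_ne_top]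
  simp only [ENNReal.toReal_ofNat]
  congr 1
  refine lintegral_congr fun t ↦ ?_
  rw [← ofReal_norm, ENNReal.ofReal_rpow_of_nonneg (norm_nonneg _) zero_le_two]
  congr 1
  simp

theorem lintegral_Iic_eq_lintegral_Ici_comp_neg (F : ℝ → ℝ≥0∞) :
    ∫⁻ t in Iic 0, F t = ∫⁻ t in Ici 0, F (-t) := by
  have h := (Measure.measurePreserving_neg (volume : Measure ℝ)).setLIntegral_comp_preimage_emb
    (MeasurableEquiv.neg ℝ).measurableEmbedding F (Iic 0)
  rw [← h]
  simp

/-- Convergence in `L²(ℝ)` is convergence in `L²` of both half-lines. -/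
theorem tendsto_eLpNorm_two_of_halves {b : ℕ → ℝ → ℝ}
    (h₁ : Tendsto (fun ν ↦ ∫⁻ t in Ici 0, ENNReal.ofReal (b ν t ^ 2)) atTop (𝓝 0))
    (h₂ : Tendsto (fun ν ↦ ∫⁻ t in Ici 0, ENNReal.ofReal (b ν (-t) ^ 2)) atTop (𝓝 0)) :
    Tendsto (fun ν ↦ eLpNorm (b ν) 2 volume) atTop (𝓝 0) := by
  have h3 : Tendsto (fun ν ↦ ∫⁻ t, ENNReal.ofReal (b ν t ^ 2)) atTop (𝓝 0) := by
    refine tendsto_of_tendsto_of_tendsto_of_le_of_le tendsto_const_nhds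
      (by simpa using h₁.add h₂) (fun _ ↦ zero_le) fun ν ↦ ?_
    have h4 := lintegral_Iic_eq_lintegral_Ici_comp_neg (fun t ↦ ENNReal.ofReal (b ν t ^ 2))
    simp only at h4 ⊢
    rw [← h4, ← setLIntegral_univ, ← Ici_union_Iic (a := (0 : ℝ))]
    exact lintegral_union_le _ _ _
  simp_rw [eLpNorm_two_eq_rpow_lintegral_sq]
  have h5 := (ENNReal.continuous_rpow_const (y := (1 / 2 : ℝ))).tendsto 0
  rw [ENNReal.zero_rpow_of_pos (by norm_num)] at h5
  exact h5.comp h3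

section HalfLine

variable {m : ℕ} {M : Type*} [TopologicalSpace M] [ChartedSpace (Model m) M]
  [IsManifold 𝓘(ℝ, Model m) ∞ M] [CompactSpace M] {f : M → ℝ} {g : Metric m M} {T : ℝ}

/-- A continuous function which is dominated by the energy density near `∞` is square
integrable. -/
theorem FlowsAfter.memLp_two (hf : ContMDiff 𝓘(ℝ, Model m) 𝓘(ℝ, ℝ) ∞ f) {u : ℝ → M}
    (hu : FlowsAfter g f T u) (hc : Continuous u) {b : ℝ → ℝ} (hb : Continuous b) {C : ℝ}
    (hle : ∀ᶠ t in atTop, b t ^ 2 ≤ C * gradSq g f (u t)) :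
    MemLp b 2 (volume.restrict (Ici 0)) := by
  rw [memLp_two_iff_integrable_sq hb.aestronglyMeasurable]
  obtain ⟨R₀, hR₀⟩ := eventually_atTop.1 hle
  set R := max R₀ T
  have h1 : IntegrableOn (fun t ↦ b t ^ 2) (Ioi R) := by
    refine Integrable.mono'
      (((hu.mono (le_max_right R₀ T)).integrableOn_gradSq hf hc).const_mul C)
      (hb.pow 2).aestronglyMeasurable ?_
    refine (ae_restrict_mem measurableSet_Ioi).mono fun t ht ↦ ?_
    rw [Real.norm_eq_abs, abs_of_nonneg (sq_nonneg _)]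
    exact hR₀ t ((le_max_left R₀ T).trans (mem_Ioi.1 ht).le)
  have h2 : IntegrableOn (fun t ↦ b t ^ 2) (Icc 0 R) :=
    (hb.pow 2).continuousOn.integrableOn_compact isCompact_Icc
  refine (h2.union h1).mono_set fun t ht ↦ ?_
  rcases le_or_gt t R with h | h
  · exact Or.inl ⟨ht, h⟩
  · exact Or.inr h

/-- Convergence in `L²` of a half-line, for functions dominated by the energy densities of flow
lines with the same limit. -/
theorem tendsto_lintegral_sq_sub (hf : ContMDiff 𝓘(ℝ, Model m) 𝓘(ℝ, ℝ) ∞ f)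
    {u : ℕ → ℝ → M} {w : ℝ → M} {q : M}
    (hu : ∀ ν, FlowsAfter g f T (u ν)) (huc : ∀ ν, Continuous (u ν))
    (huq : ∀ ν, Tendsto (u ν) atTop (𝓝 q)) (hw : FlowsAfter g f T w) (hwc : Continuous w)
    (hwq : Tendsto w atTop (𝓝 q)) (h : LocConv u w) {b : ℕ → ℝ → ℝ} {b₀ : ℝ → ℝ}
    (hb₀ : Continuous b₀) (hb : LocConv b b₀) {C : ℝ} (hC : 0 ≤ C)
    (hle₀ : ∀ᶠ t in atTop, b₀ t ^ 2 ≤ C * gradSq g f (w t))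
    (hle : ∃ R, ∀ᶠ ν in atTop, ∀ t ≥ R, b ν t ^ 2 ≤ C * gradSq g f (u ν t)) :
    Tendsto (fun ν ↦ ∫⁻ t in Ici 0, ENNReal.ofReal ((b ν t - b₀ t) ^ 2)) atTop (𝓝 0) := by
  obtain ⟨R₁, hR₁⟩ := hle
  suffices key : ∀ η : ℝ, 0 < η → ∀ᶠ ν in atTop,
      ∫⁻ t in Ici 0, ENNReal.ofReal ((b ν t - b₀ t) ^ 2) ≤ ENNReal.ofReal η by
    rw [ENNReal.tendsto_nhds_zero]
    intro ε hε
    by_cases htop : ε = ⊤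
    · simp [htop]
    · have := key ε.toReal (ENNReal.toReal_pos hε.ne' htop)
      rwa [ENNReal.ofReal_toReal htop] at this
  intro η hη
  -- By `(x - y)² ≤ 2x² + 2y²` and the energy identity, the integral over `(R, ∞)` is at most `2C (f
  -- (u_ν R) - f q) + 2C (f (w R) - f q)`. The common limit `q` makes this small for large `ν` once
  -- `R` is large.
  have hval : Tendsto (fun t ↦ 2 * C * (f (w t) - f q)) atTop (𝓝 0) := by
    have := (((hf.continuous.tendsto q).comp hwq).sub_const (f q)).const_mul (2 * C)
    simpa using this
  obtain ⟨R, hRη, hRle⟩ :=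
    ((hval.eventually (eventually_lt_nhds (show 0 < η / 4 by positivity))).and
    ((eventually_forall_ge_atTop.2 hle₀).and ((eventually_ge_atTop R₁).and
      ((eventually_ge_atTop T).and (eventually_ge_atTop 0))))).exists
  obtain ⟨hR₀, hRR₁, hRT, hR0⟩ := hRle
  have hev : ∀ᶠ ν in atTop, 2 * C * (f (u ν R) - f q) < η / 4 := by
    have := (((h.comp_continuous hf.continuous).tendsto R).sub_const (f q)).const_mul (2 * C)
    exact this.eventually (eventually_lt_nhds hRη)
  -- Chosen so that `δ² R ≤ η / 4` on `[0, R]`; `R + 1` avoids dividing by zero when `R = 0`.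
  set δ : ℝ := √(η / (4 * (R + 1))) with hδ
  have hδpos : 0 < δ := Real.sqrt_pos.2 (by positivity)
  have hunif : ∀ᶠ ν in atTop, ∀ t ∈ Icc 0 R, b ν t - b₀ t ∈ Metric.ball (0 : ℝ) δ := by
    have h1 : LocConv (fun ν t ↦ b ν t - b₀ t) (fun _ ↦ (0 : ℝ)) := fun t ↦ by
      have := (hb t).sub ((hb₀.tendsto t).comp tendsto_snd)
      simpa using this
    exact h1.eventually_forall_mem isCompact_Icc Metric.isOpen_ball
      fun _ _ ↦ Metric.mem_ball_self hδpos
  filter_upwards [hev, hunif, hR₁] with ν hν₁ hν₂ hν₃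
  have hI₁ : ∫⁻ t in Icc 0 R, ENNReal.ofReal ((b ν t - b₀ t) ^ 2) ≤ ENNReal.ofReal (η / 4) := by
    calc _ ≤ ∫⁻ _ in Icc 0 R, ENNReal.ofReal (η / (4 * (R + 1))) := by
          refine setLIntegral_mono' measurableSet_Icc fun t ht ↦ ENNReal.ofReal_le_ofReal ?_
          have h2 := hν₂ t ht
          rw [mem_ball_zero_iff, Real.norm_eq_abs] at h2
          rw [← sq_abs, ← Real.sq_sqrt (show 0 ≤ η / (4 * (R + 1)) by positivity)]
          gcongr
      _ = ENNReal.ofReal (η / (4 * (R + 1)) * R) := by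
          rw [setLIntegral_const, Real.volume_Icc, sub_zero,
            ENNReal.ofReal_mul (by positivity)]
      _ ≤ ENNReal.ofReal (η / 4) := by
          refine ENNReal.ofReal_le_ofReal ?_
          rw [div_mul_eq_mul_div, div_le_div_iff₀ (by positivity) (by positivity)]
          nlinarith
  have hI₂ : ∫⁻ t in Ioi R, ENNReal.ofReal ((b ν t - b₀ t) ^ 2) ≤ ENNReal.ofReal (η / 2) := by
    have hi₁ := ((hu ν).mono hRT).integrableOn_gradSq hf (huc ν)
    have hi₂ := (hw.mono hRT).integrableOn_gradSq hf hwc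
    calc _ ≤ ∫⁻ t in Ioi R, ENNReal.ofReal
            (2 * C * gradSq g f (u ν t) + 2 * C * gradSq g f (w t)) := by
          refine setLIntegral_mono' measurableSet_Ioi fun t ht ↦ ENNReal.ofReal_le_ofReal ?_
          have h3 := hν₃ t (hRR₁.trans (mem_Ioi.1 ht).le)
          have h4 := hR₀ t (mem_Ioi.1 ht).le
          nlinarith [sq_nonneg (b ν t + b₀ t)]
      _ = ENNReal.ofReal (∫ t in Ioi R,
            (2 * C * gradSq g f (u ν t) + 2 * C * gradSq g f (w t))) := by
          refine (ofReal_integral_eq_lintegral_ofReal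
            ((hi₁.const_mul (2 * C)).add (hi₂.const_mul (2 * C))) ?_).symm
          refine Eventually.of_forall fun t ↦ ?_
          have h2C : 0 ≤ 2 * C := by positivity
          exact add_nonneg (mul_nonneg h2C (gradSq_nonneg g f _))
            (mul_nonneg h2C (gradSq_nonneg g f _))
      _ ≤ ENNReal.ofReal (η / 2) := by
          refine ENNReal.ofReal_le_ofReal ?_
          rw [integral_add (hi₁.const_mul (2 * C)) (hi₂.const_mul (2 * C)), integral_const_mul,
            integral_const_mul, ((hu ν).mono hRT).integral_gradSq hf (huc ν) (huq ν),
            (hw.mono hRT).integral_gradSq hf hwc hwq]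
          linarith
  calc _ ≤ ∫⁻ t in Icc 0 R ∪ Ioi R, ENNReal.ofReal ((b ν t - b₀ t) ^ 2) := by
        refine lintegral_mono_set fun t ht ↦ ?_
        rcases le_or_gt t R with h | h
        · exact Or.inl ⟨ht, h⟩
        · exact Or.inr h
    _ ≤ _ := lintegral_union_le _ _ _
    _ ≤ ENNReal.ofReal (η / 4) + ENNReal.ofReal (η / 2) := add_le_add hI₁ hI₂
    _ ≤ ENNReal.ofReal η := by
        rw [← ENNReal.ofReal_add (by positivity) (by positivity)]
        exact ENNReal.ofReal_le_ofReal (by linarith)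

end HalfLine

/-! ### Time shifts and time reversal. -/

section Reparametrization

variable {m : ℕ} {M : Type*} [TopologicalSpace M] [ChartedSpace (Model m) M]
  {u : ℝ → M} {t : ℝ}

theorem hasMFDerivAt_comp_add {a : ℝ} {v : TangentSpace 𝓘(ℝ, Model m) (u (t + a))}
    (h : HasMFDerivAt 𝓘(ℝ, ℝ) 𝓘(ℝ, Model m) u (t + a) ((1 : ℝ →L[ℝ] ℝ).smulRight v)) :
    HasMFDerivAt 𝓘(ℝ, ℝ) 𝓘(ℝ, Model m) (fun τ ↦ u (τ + a)) t ((1 : ℝ →L[ℝ] ℝ).smulRight v) := by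
  have h1 : HasMFDerivAt 𝓘(ℝ, ℝ) 𝓘(ℝ, ℝ) (fun τ : ℝ ↦ τ + a) t (1 : ℝ →L[ℝ] ℝ) :=
    ((hasFDerivAt_id t).add_const a).hasMFDerivAt
  exact HasMFDerivAt.comp t h h1

theorem hasMFDerivAt_comp_neg {v : TangentSpace 𝓘(ℝ, Model m) (u (-t))}
    (h : HasMFDerivAt 𝓘(ℝ, ℝ) 𝓘(ℝ, Model m) u (-t) ((1 : ℝ →L[ℝ] ℝ).smulRight v)) :
    HasMFDerivAt 𝓘(ℝ, ℝ) 𝓘(ℝ, Model m) (fun τ ↦ u (-τ)) t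
      ((1 : ℝ →L[ℝ] ℝ).smulRight (-v)) := by
  have h1 : HasMFDerivAt 𝓘(ℝ, ℝ) 𝓘(ℝ, ℝ) (fun τ : ℝ ↦ -τ) t (-(1 : ℝ →L[ℝ] ℝ)) :=
    (hasFDerivAt_id t).neg.hasMFDerivAt
  have h2 : ∀ v : Model m, (1 : ℝ →L[ℝ] ℝ).smulRight (-v) =
      ((1 : ℝ →L[ℝ] ℝ).smulRight v).comp (-(1 : ℝ →L[ℝ] ℝ)) := fun v ↦
    ContinuousLinearMap.ext_ring (by simp)
  have h3 := HasMFDerivAt.comp t h h1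
  exact (h2 v).symm ▸ h3

end Reparametrization

section Reversal

variable {m : ℕ} {M : Type*} [TopologicalSpace M] [ChartedSpace (Model m) M]
  {f : M → ℝ}

theorem isCritical_neg {c : M} : IsCritical m (-f) c ↔ IsCritical m f c := by
  have h : mfderiv 𝓘(ℝ, Model m) 𝓘(ℝ, ℝ) (-f) c = -mfderiv 𝓘(ℝ, Model m) 𝓘(ℝ, ℝ) f c :=
    mfderiv_neg
  rw [IsCritical, IsCritical, h]
  exact neg_eq_zero

theorem hessian_neg (c : M) : hessian m (-f) c = -hessian m f c := by
  have h : fderiv ℝ ((-f) ∘ (extChartAt 𝓘(ℝ, Model m) c).symm) =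
      -fderiv ℝ (f ∘ (extChartAt 𝓘(ℝ, Model m) c).symm) := by
    ext1 y
    exact fderiv_neg
  rw [hessian, hessian, h]
  exact fderiv_neg

theorem IsMorse.neg (hf : IsMorse m f) : IsMorse m (-f) where
  smooth := hf.smooth.neg
  nondegenerate p hp v hv := hf.nondegenerate p (isCritical_neg.1 hp) v fun w ↦ by
    have := hv w
    rw [hessian_neg] at this
    simpa using this

variable [IsManifold 𝓘(ℝ, Model m) ∞ M] {g : Metric m M}

/-- Reversing time and replacing `f` by `-f` turns the end `-∞` into `+∞`, so every half-line result
serves both ends. -/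
theorem FlowsAfter.of_reverse {T : ℝ} {u : ℝ → M} (hu : ∀ t < -T,
    HasMFDerivAt 𝓘(ℝ, ℝ) 𝓘(ℝ, Model m) u t ((1 : ℝ →L[ℝ] ℝ).smulRight (-gradient g f (u t)))) :
    FlowsAfter g (-f) T (fun t ↦ u (-t)) := by
  intro t ht
  have h := hasMFDerivAt_comp_neg (hu (-t) (neg_lt_neg ht))
  rwa [← neg_gradient g f]

theorem IsFlowLine.flowsAfter {u : ℝ → M} (hu : IsFlowLine (fun _ ↦ g) (fun _ ↦ f) u) (T : ℝ) :
    FlowsAfter g f T u := fun t _ ↦ hu t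

theorem IsFlowLine.reverse {u : ℝ → M} (hu : IsFlowLine (fun _ ↦ g) (fun _ ↦ f) u) :
    IsFlowLine (fun _ ↦ g) (fun _ ↦ -f) (fun t ↦ u (-t)) := fun t ↦
  FlowsAfter.of_reverse (T := t - 1) (fun τ _ ↦ hu τ) t (by linarith)

end Reversal

/-! ### Breaking into chains of flow lines. -/

section Chain

variable {m : ℕ} {M : Type*} [TopologicalSpace M] [ChartedSpace (Model m) M]
  [IsManifold 𝓘(ℝ, Model m) ∞ M]

/-- A chain of `N` flow lines of `f` from `c` to `q`, which are limits of shifts of `u_ν` by times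
tending to `∞`. -/
structure IsChain (g : Metric m M) (f : M → ℝ) (u : ℕ → ℝ → M) (c q : M) (N : ℕ) (cs : ℕ → M)
    (ws : ℕ → ℝ → M) (rs : ℕ → ℕ → ℝ) : Prop where
  zero : cs 0 = c
  last : cs N = q
  critical : ∀ k ≤ N, IsCritical m f (cs k)
  flow : ∀ k < N, IsFlowLine (fun _ ↦ g) (fun _ ↦ f) (ws k)
  continuous : ∀ k < N, Continuous (ws k)
  tendsto_atBot : ∀ k < N, Tendsto (ws k) atBot (𝓝 (cs k))
  tendsto_atTop : ∀ k < N, Tendsto (ws k) atTop (𝓝 (cs (k + 1)))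
  nonconstant : ∀ k < N, ∀ x, ws k ≠ fun _ ↦ x
  shift : ∀ k < N, Tendsto (rs k) atTop atTop
  locConv : ∀ k < N, LocConv (fun ν t ↦ u ν (t + rs k ν)) (ws k)

theorem IsChain.subseq {g : Metric m M} {f : M → ℝ} {u : ℕ → ℝ → M} {c q : M} {N : ℕ}
    {cs : ℕ → M} {ws : ℕ → ℝ → M} {rs : ℕ → ℕ → ℝ} (h : IsChain g f u c q N cs ws rs)
    {j : ℕ → ℕ} (hj : StrictMono j) :
    IsChain g f (fun ν ↦ u (j ν)) c q N cs ws (fun k ν ↦ rs k (j ν)) :=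
  { h with
    shift := fun k hk ↦ (h.shift k hk).comp hj.tendsto_atTop
    locConv := fun k hk ↦ (h.locConv k hk).subseq hj }

variable [T2Space M] [CompactSpace M] {f : M → ℝ} {g : Metric m M} {n : ℕ} {e : M → Fin n → ℝ}
  {K : NNReal} {T : ℝ}

/-- As the shifts tend to `∞`, every bounded time window is moved beyond `T`, so the limit solves
the autonomous equation on all of `ℝ`. -/
theorem exists_subseq_shift (hf : ContMDiff 𝓘(ℝ, Model m) 𝓘(ℝ, ℝ) ∞ f) (he : IsClosedEmbedding e)
    {u : ℕ → ℝ → M} (hLip : ∀ ν, LipschitzWith K (fun t ↦ e (u ν t)))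
    (hu : ∀ ν, FlowsAfter g f T (u ν)) {r : ℕ → ℝ} (hr : Tendsto r atTop atTop) :
    ∃ j : ℕ → ℕ, StrictMono j ∧ ∃ w : ℝ → M, Continuous w ∧
      IsFlowLine (fun _ ↦ g) (fun _ ↦ f) w ∧
      LocConv (fun ν t ↦ u (j ν) (t + r (j ν))) w := by
  obtain ⟨j, hj, w, hw, hlim⟩ := exists_subseq_locConv he (K := K)
    (u := fun ν t ↦ u ν (t + r ν)) fun ν x y ↦ by
      simpa using hLip ν (x + r ν) (y + r ν)
  refine ⟨j, hj, w, hw, ?_, hlim⟩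
  refine hlim.isFlowLine (IsHomotopy.const 0 hf g) (s := fun _ ↦ 0) (s₀ := 0)
    (fun _ ↦ zero_mem_cube 0) (zero_mem_cube 0) tendsto_const_nhds hw fun t ↦ ?_
  have h1 : ∀ᶠ ν in atTop, T - t + 1 < r (j ν) :=
    (hr.comp hj.tendsto_atTop).eventually_gt_atTop _
  have h2 : ∀ᶠ τ in 𝓝 t, t - 1 < τ := eventually_gt_nhds (by linarith)
  refine (h1.prod_mk h2).mono fun y hy ↦ ?_
  exact hasMFDerivAt_comp_add (hu _ _ (by linarith [hy.1, hy.2]))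

end Chain

theorem exists_exit_time {X : Type*} [TopologicalSpace X] {γ : ℝ → X} (hγ : Continuous γ)
    {O : Set X} (hO : IsOpen O) {R : ℝ} (h : ∃ t ≥ R, γ t ∉ O) :
    ∃ τ ≥ R, γ τ ∉ O ∧ ∀ t, R ≤ t → t < τ → γ t ∈ O := by
  set S : Set ℝ := Ici R ∩ γ ⁻¹' Oᶜ with hS
  have hcl : IsClosed S := isClosed_Ici.inter (hO.isClosed_compl.preimage hγ)
  have hne : S.Nonempty := h
  have hbdd : BddBelow S := ⟨R, fun t ht ↦ ht.1⟩
  have hmem := hcl.csInf_mem hne hbdd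
  refine ⟨sInf S, hmem.1, hmem.2, fun t hRt ht ↦ ?_⟩
  by_contra hO
  exact notMem_of_lt_csInf ht hbdd ⟨hRt, hO⟩

section Chain

variable {m : ℕ} {M : Type*} [TopologicalSpace M] [ChartedSpace (Model m) M]
  [IsManifold 𝓘(ℝ, Model m) ∞ M] {f : M → ℝ} {g : Metric m M}

theorem IsChain.cons {u : ℕ → ℝ → M} {c c₁ q : M} {N : ℕ} {cs : ℕ → M} {ws : ℕ → ℝ → M}
    {rs : ℕ → ℕ → ℝ} (h : IsChain g f u c₁ q N cs ws rs) (hc : IsCritical m f c) {w : ℝ → M}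
    {r : ℕ → ℝ} (hw : IsFlowLine (fun _ ↦ g) (fun _ ↦ f) w) (hwc : Continuous w)
    (hbot : Tendsto w atBot (𝓝 c)) (htop : Tendsto w atTop (𝓝 c₁)) (hne : ∀ x, w ≠ fun _ ↦ x)
    (hr : Tendsto r atTop atTop) (hlim : LocConv (fun ν t ↦ u ν (t + r ν)) w) :
    IsChain g f u c q (N + 1) (Nat.rec c fun k _ ↦ cs k) (Nat.rec w fun k _ ↦ ws k)
      (Nat.rec r fun k _ ↦ rs k) where
  zero := rfl
  last := h.last
  critical
    | 0, _ => hc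
    | k + 1, hk => h.critical k (by omega)
  flow
    | 0, _ => hw
    | k + 1, hk => h.flow k (by omega)
  continuous
    | 0, _ => hwc
    | k + 1, hk => h.continuous k (by omega)
  tendsto_atBot
    | 0, _ => hbot
    | k + 1, hk => h.tendsto_atBot k (by omega)
  tendsto_atTop
    | 0, _ => by simpa [h.zero] using htop
    | k + 1, hk => h.tendsto_atTop k (by omega)
  nonconstant
    | 0, _ => hne
    | k + 1, hk => h.nonconstant k (by omega)
  shift
    | 0, _ => hr
    | k + 1, hk => h.shift k (by omega)
  locConv
    | 0, _ => hlim
    | k + 1, hk => h.locConv k (by omega)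

theorem IsFlowLine.antitone (hf : ContMDiff 𝓘(ℝ, Model m) 𝓘(ℝ, ℝ) ∞ f) {w : ℝ → M}
    (hw : IsFlowLine (fun _ ↦ g) (fun _ ↦ f) w) : Antitone (fun t ↦ f (w t)) :=
  antitone_of_deriv_nonpos (fun t ↦ (hasDerivAt_comp_flow hf (hw t)).differentiableAt) fun t ↦ by
    rw [(hasDerivAt_comp_flow hf (hw t)).deriv]
    exact neg_nonpos.2 (gradSq_nonneg g f _)

/-- A flow line through a non-critical point strictly decreases the function. -/
theorem IsFlowLine.lt_of_tendsto (hf : ContMDiff 𝓘(ℝ, Model m) 𝓘(ℝ, ℝ) ∞ f) {w : ℝ → M}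
    (hw : IsFlowLine (fun _ ↦ g) (fun _ ↦ f) w) {t : ℝ} (ht : ¬ IsCritical m f (w t)) {a b : M}
    (ha : Tendsto w atBot (𝓝 a)) (hb : Tendsto w atTop (𝓝 b)) : f b < f a := by
  by_contra! hle
  have hanti := hw.antitone hf
  have h1 : ∀ τ, f (w τ) = f a := fun τ ↦ le_antisymm
    (hanti.ge_of_tendsto ((hf.continuous.tendsto a).comp ha) τ)
    (hle.trans (hanti.le_of_tendsto ((hf.continuous.tendsto b).comp hb) τ))
  have h2 := hasDerivAt_comp_flow hf (hw t)
  simp_rw [h1] at h2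
  have h3 := h2.unique (hasDerivAt_const t (f a))
  exact ht ((gradSq_eq_zero_iff g f _).1 (neg_eq_zero.1 h3))

variable [T2Space M] [CompactSpace M] {n : ℕ} {e : M → Fin n → ℝ} {K : NNReal} {T : ℝ}

theorem IsFlowLine.exists_tendsto_atBot (hf : IsMorse m f) {w : ℝ → M}
    (hw : IsFlowLine (fun _ ↦ g) (fun _ ↦ f) w) (hwc : Continuous w) :
    ∃ c, IsCritical m f c ∧ Tendsto w atBot (𝓝 c) := by
  obtain ⟨c, hc, h⟩ := (hw.reverse.flowsAfter 0).exists_tendsto hf.neg (hwc.comp continuous_neg)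
  refine ⟨c, isCritical_neg.1 hc, ?_⟩
  simpa [Function.comp_def] using h.comp tendsto_neg_atBot_atTop

/-- If flow lines stay close to a critical point for longer and longer times and then leave,
suitable shifts converge to a flow line emanating from the critical point. -/
theorem exists_subseq_leaving (hf : IsMorse m f) (he : IsClosedEmbedding e) {u : ℕ → ℝ → M}
    (huc : ∀ ν, Continuous (u ν)) (hLip : ∀ ν, LipschitzWith K (fun t ↦ e (u ν t)))
    (hu : ∀ ν, FlowsAfter g f T (u ν)) {r : ℕ → ℝ} (hr : ∀ᶠ ν in atTop, 0 ≤ r ν) {w : ℝ → M}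
    (hw : LocConv (fun ν t ↦ u ν (t + r ν)) w) {c : M} {V : Set M}
    (hV : IsIsolating (m := m) f c V) {R : ℝ} (hR : ∀ t ≥ R, w t ∈ interior V)
    (hexit : ∃ᶠ ν in atTop, ∃ t ≥ R, u ν (t + r ν) ∉ interior V) :
    ∃ j : ℕ → ℕ, StrictMono j ∧ ∃ (b : ℕ → ℝ) (w' : ℝ → M), Tendsto b atTop atTop ∧
      IsFlowLine (fun _ ↦ g) (fun _ ↦ f) w' ∧ Continuous w' ∧ Tendsto w' atBot (𝓝 c) ∧
      ¬ IsCritical m f (w' 0) ∧ LocConv (fun ν t ↦ u (j ν) (t + b ν)) w' := by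
  obtain ⟨i, hi, hex⟩ := extraction_of_frequently_atTop hexit
  have hex' := fun ν ↦ exists_exit_time (γ := fun t ↦ u (i ν) (t + r (i ν)))
    ((huc _).comp (continuous_add_const _)) isOpen_interior (hex ν)
  choose τ hRτ hτ hbefore using hex'
  -- On each `[R, A]` the curves converge uniformly to `w`, which lies in `interior V` there; so
  -- they cannot exit before `A`.
  have hτtop : Tendsto τ atTop atTop := by
    refine tendsto_atTop.2 fun A ↦ ?_
    filter_upwards [(hw.subseq hi).eventually_forall_mem (isCompact_Icc (a := R) (b := A))
      isOpen_interior fun t ht ↦ hR t ht.1] with ν hν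
    by_contra! hA
    exact hτ ν (hν _ ⟨hRτ ν, hA.le⟩)
  have hb : Tendsto (fun ν ↦ τ ν + r (i ν)) atTop atTop :=
    tendsto_atTop_mono' _ ((hi.tendsto_atTop.eventually hr).mono fun ν hν ↦ by
      simpa using hν) hτtop
  obtain ⟨k, hk, w', hw'c, hw'f, hlim⟩ := exists_subseq_shift hf.smooth he
    (u := fun ν ↦ u (i ν)) (fun ν ↦ hLip _) (fun ν ↦ hu _) hb
  -- Before its exit time each curve lies in `V`, from time `R` on. Hence the backward limit of `w'`
  -- is a critical point in `V`, that is, `c`.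
  have hneg : ∀ t < 0, w' t ∈ V := fun t ht ↦ by
    refine hV.isClosed.mem_of_tendsto (hlim.tendsto t) ?_
    filter_upwards [(hτtop.comp hk.tendsto_atTop).eventually_ge_atTop (R - t)] with ν hν
    have h1 := hbefore (k ν) (t + τ (k ν)) (by simp at hν; linarith) (by linarith)
    rw [add_assoc] at h1
    exact interior_subset h1
  -- The point `w' 0` lies in `V` but not in its interior, whereas the only critical point of `V` is
  -- interior.
  have h0 : w' 0 ∉ interior V := by
    refine isOpen_interior.isClosed_compl.mem_of_tendsto (hlim.tendsto 0)
      (Eventually.of_forall fun ν ↦ ?_)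
    rw [zero_add]
    exact hτ (k ν)
  have h0V : w' 0 ∈ V := hV.isClosed.mem_of_tendsto
    ((hw'c.tendsto 0).mono_left (nhdsWithin_le_nhds (s := Iio 0)))
    (eventually_mem_nhdsWithin.mono hneg)
  obtain ⟨c', hc', hbot⟩ := hw'f.exists_tendsto_atBot hf hw'c
  have hc'V : c' ∈ V := hV.isClosed.mem_of_tendsto hbot ((eventually_lt_atBot 0).mono hneg)
  refine ⟨fun ν ↦ i (k ν), hi.comp hk, fun ν ↦ τ (k ν) + r (i (k ν)), w',
    hb.comp hk.tendsto_atTop, hw'f, hw'c, hV.eq_of_isCritical c' hc'V hc' ▸ hbot, fun h ↦ ?_, hlim⟩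
  exact h0 (hV.eq_of_isCritical _ h0V h ▸ mem_interior_iff_mem_nhds.2 hV.mem_nhds)

/-- Compactness for flow lines on a half-line: beyond the range of the limit `w`, a subsequence
converges to a chain of flow lines ending at the common limit `q`.  If the chain is empty, the
flow lines stay close to `q` uniformly in `ν`. -/
theorem exists_chain (hf : IsMorse m f) (he : IsClosedEmbedding e) {q : M} (hq : IsCritical m f q)
    {u : ℕ → ℝ → M} (huc : ∀ ν, Continuous (u ν))
    (hLip : ∀ ν, LipschitzWith K (fun t ↦ e (u ν t)))
    (hu : ∀ ν, FlowsAfter g f T (u ν)) (huq : ∀ ν, Tendsto (u ν) atTop (𝓝 q)) {r : ℕ → ℝ}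
    (hr : ∀ᶠ ν in atTop, 0 ≤ r ν) {w : ℝ → M} (hw : LocConv (fun ν t ↦ u ν (t + r ν)) w)
    {c : M} (hc : IsCritical m f c) (hwc : Tendsto w atTop (𝓝 c)) :
    ∃ j : ℕ → ℕ, StrictMono j ∧ ∃ (N : ℕ) (cs : ℕ → M) (ws : ℕ → ℝ → M) (rs : ℕ → ℕ → ℝ),
      IsChain g f (fun ν ↦ u (j ν)) c q N cs ws rs ∧
      (N = 0 → ∃ V, IsIsolating (m := m) f q V ∧ ∃ R, ∀ᶠ ν in atTop, ∀ t ≥ R,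
        u (j ν) (t + r (j ν)) ∈ V) := by
  -- The number of critical points below level `f c` drops with each breaking. The curve `w` need
  -- not be an `f`-line and `r` need not diverge, so the induction can start from the unshifted
  -- limit of the homotopy flow lines.
  induction hN : {x | IsCritical m f x ∧ f x < f c}.ncard using Nat.strong_induction_on
    generalizing u r w c with
  | _ d ih =>
  obtain ⟨V, -, hV⟩ := hf.exists_isIsolating g hc univ_mem
  obtain ⟨R, hR⟩ := eventually_atTop.1 (hwc.eventually (interior_mem_nhds.2 hV.mem_nhds))
  by_cases hexit : ∃ᶠ ν in atTop, ∃ t ≥ R, u ν (t + r ν) ∉ interior V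
  · obtain ⟨j, hj, b, w', hb, hw'f, hw'c, hbot, h0, hlim⟩ :=
      exists_subseq_leaving hf he huc hLip hu hr hw hV hR hexit
    obtain ⟨c', hc', htop⟩ := (hw'f.flowsAfter 0).exists_tendsto hf hw'c
    have hlt : f c' < f c := hw'f.lt_of_tendsto hf.smooth h0 hbot htop
    have hcard : {x | IsCritical m f x ∧ f x < f c'}.ncard < d := by
      rw [← hN]
      refine ncard_lt_ncard ⟨fun x hx ↦ ⟨hx.1, hx.2.trans hlt⟩, fun h ↦ ?_⟩
        ((hf.finite_critical g).subset fun x hx ↦ hx.1)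
      exact lt_irrefl _ (h ⟨hc', hlt⟩).2
    obtain ⟨i, hi, N, cs, ws, rs, hchain, -⟩ := ih _ hcard (u := fun ν ↦ u (j ν))
      (fun ν ↦ huc _) (fun ν ↦ hLip _) (fun ν ↦ hu _) (fun ν ↦ huq _) (hb.eventually_ge_atTop 0)
      hlim hc' htop rfl
    refine ⟨fun ν ↦ j (i ν), hj.comp hi, N + 1, _, _, _,
      hchain.cons hc hw'f hw'c hbot htop (fun x hx ↦ ?_) (hb.comp hi.tendsto_atTop)
        (hlim.subseq hi), by simp⟩
    rw [hx] at hbot htop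
    exact hlt.ne (congrArg f ((tendsto_nhds_unique tendsto_const_nhds htop).symm.trans
      (tendsto_nhds_unique tendsto_const_nhds hbot)))
  -- No further exit: almost all curves stay in `V` after `R`, so their limit `q` lies in `V` and
  -- must be `c`.
  · have hstay : ∀ᶠ ν in atTop, ∀ t ≥ R, u ν (t + r ν) ∈ V := by
      filter_upwards [not_frequently.1 hexit] with ν hν t ht
      by_contra h
      exact hν ⟨t, ht, fun h' ↦ h (interior_subset h')⟩
    obtain ⟨ν, hν⟩ := hstay.exists
    have hqV : q ∈ V := hV.isClosed.mem_of_tendsto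
      ((huq ν).comp (tendsto_atTop_add_const_right atTop (r ν) tendsto_id))
      ((eventually_ge_atTop R).mono hν)
    obtain rfl := hV.eq_of_isCritical q hqV hq
    exact ⟨id, strictMono_id, 0, fun _ ↦ q, fun _ ↦ w, fun _ ↦ r,
      { zero := rfl
        last := rfl
        critical := fun _ _ ↦ hc
        flow := by simp
        continuous := by simp
        tendsto_atBot := by simp
        tendsto_atTop := by simp
        nonconstant := by simp
        shift := by simp
        locConv := by simp }, fun _ ↦ ⟨V, hV, R, hstay⟩⟩

end Chain

/-! ### Uniform Lipschitz bounds for homotopy flow lines. -/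

section Lipschitz

variable {m ℓ : ℕ} {M : Type*} [TopologicalSpace M] [ChartedSpace (Model m) M]
  [IsManifold 𝓘(ℝ, Model m) ∞ M] {fα fβ : M → ℝ} {gα gβ : Metric m M}
  {H : (Fin ℓ → ℝ) → ℝ → M → ℝ} {G : (Fin ℓ → ℝ) → ℝ → Metric m M}

variable (m M) in
theorem exists_isClosedEmbedding_pi [T2Space M] [CompactSpace M] :
    ∃ (n : ℕ) (e : M → Fin n → ℝ), IsClosedEmbedding e ∧
      ∀ i, ContMDiff 𝓘(ℝ, Model m) 𝓘(ℝ, ℝ) ∞ (fun x ↦ e x i) := by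
  obtain ⟨n, e, he, hemb, -⟩ := exists_embedding_euclidean_of_compact (M := M) (I := 𝓘(ℝ, Model m))
  refine ⟨n, fun x ↦ WithLp.ofLp (e x), ?_, fun i ↦ ?_⟩
  · exact (PiLp.homeomorph 2 (fun _ : Fin n ↦ ℝ)).isClosedEmbedding.comp hemb
  · exact (EuclideanSpace.proj (𝕜 := ℝ) i).contMDiff.comp he

/-- Derivatives along the flow lines of a homotopy are uniformly bounded. -/
theorem IsHomotopy.exists_bound_flowDeriv_one [CompactSpace M] (hHG : IsHomotopy fα gα fβ gβ H G)
    {φ : M → ℝ} (hφ : ContMDiff 𝓘(ℝ, Model m) 𝓘(ℝ, ℝ) ∞ φ) :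
    ∃ C, ∀ z ∈ domain ℓ M, ‖flowDeriv H G φ 1 z‖ ≤ C := by
  obtain ⟨T, hT, hfin⟩ := hHG.finite
  -- The bound on this compact set suffices: later or earlier times have the same `(H, G)` as `±(T +
  -- 1)`. The `+ 1` is needed because the homotopy is known to be constant only strictly outside
  -- `[-T, T]`.
  have hcpt : IsCompact ((cube ℓ ×ˢ Icc (-(T + 1)) (T + 1)) ×ˢ (univ : Set M)) :=
    (isCompact_Icc.prod isCompact_Icc).prod isCompact_univ
  obtain ⟨C, hC⟩ := hcpt.exists_bound_of_continuousOn
    ((contMDiffOn_flowDeriv hHG hφ 1).continuousOn.mono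
      (prod_mono_left (prod_mono_right (subset_univ _))))
  refine ⟨C, ?_⟩
  rintro ⟨⟨s, t⟩, x⟩ ⟨⟨hs, -⟩, -⟩
  have key : ∀ t', t' ∈ Icc (-(T + 1)) (T + 1) → H s t = H s t' → G s t = G s t' →
      ‖flowDeriv H G φ 1 ((s, t), x)‖ ≤ C := by
    intro t' ht' hH hG
    refine le_of_eq_of_le ?_ (hC ((s, t'), x) ⟨⟨hs, ht'⟩, mem_univ _⟩)
    have h1 := flowDeriv_one (H := H) (G := G) (z := ((s, t), x)) hφ ⟨⟨hs, mem_univ _⟩, mem_univ _⟩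
    have h2 := flowDeriv_one (H := H) (G := G) (z := ((s, t'), x)) hφ ⟨⟨hs, mem_univ _⟩, mem_univ _⟩
    simp only [← hH, ← hG] at h1 h2
    exact congrArg norm (h1.trans h2.symm)
  obtain ⟨hl, hr⟩ := hfin s hs
  rcases lt_or_ge t (-(T + 1)) with h | h
  · obtain ⟨h1, h2⟩ := hl t (by linarith)
    obtain ⟨h3, h4⟩ := hl (-(T + 1)) (by linarith)
    exact key (-(T + 1)) ⟨le_rfl, by linarith⟩ (h1.trans h3.symm) (h2.trans h4.symm)
  rcases lt_or_ge (T + 1) t with h' | h'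
  · obtain ⟨h1, h2⟩ := hr t (by linarith)
    obtain ⟨h3, h4⟩ := hr (T + 1) (by linarith)
    exact key (T + 1) ⟨by linarith, le_rfl⟩ (h1.trans h3.symm) (h2.trans h4.symm)
  · exact key t ⟨h, h'⟩ rfl rfl

/-- The flow lines of a homotopy are uniformly Lipschitz. -/
theorem IsHomotopy.exists_lipschitzWith [CompactSpace M] (hHG : IsHomotopy fα gα fβ gβ H G)
    {n : ℕ} {e : M → Fin n → ℝ}
    (he : ∀ i, ContMDiff 𝓘(ℝ, Model m) 𝓘(ℝ, ℝ) ∞ (fun x ↦ e x i)) :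
    ∃ K : NNReal, ∀ s ∈ cube ℓ, ∀ u : ℝ → M, IsFlowLine (G s) (H s) u →
      LipschitzWith K (fun t ↦ e (u t)) := by
  choose C hC using fun i ↦ hHG.exists_bound_flowDeriv_one (he i)
  refine ⟨Finset.univ.sup fun i ↦ (C i).toNNReal, fun s hs u hu ↦ ?_⟩
  have hi : ∀ i, LipschitzWith (C i).toNNReal (fun t ↦ e (u t) i) := fun i ↦ by
    have hd : ∀ t, HasDerivAt (fun t ↦ e (u t) i)
        (flowDeriv H G (fun x ↦ e x i) 1 ((s, t), u t)) t :=
      fun t ↦ hasDerivAt_flowDeriv hHG (he i) 0 hs (hu t)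
    refine lipschitzWith_of_nnnorm_deriv_le (fun t ↦ (hd t).differentiableAt) fun t ↦ ?_
    rw [(hd t).deriv, ← NNReal.coe_le_coe, coe_nnnorm]
    exact (hC i _ ⟨⟨hs, mem_univ _⟩, mem_univ _⟩).trans (Real.le_coe_toNNReal _)
  refine fun x y ↦ edist_pi_le_iff.2 fun i ↦ (hi i x y).trans ?_
  gcongr
  exact Finset.le_sup (f := fun i ↦ (C i).toNNReal) (Finset.mem_univ i)

end Lipschitz

/-! ### Test functions along half-lines. -/

section HalfLine

variable {m : ℕ} {M : Type*} [TopologicalSpace M] [ChartedSpace (Model m) M]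
  [IsManifold 𝓘(ℝ, Model m) ∞ M] [CompactSpace M] {f : M → ℝ} {g : Metric m M} {T : ℝ}

theorem FlowsAfter.memLp_sub (hf : IsMorse m f) {q : M} (hq : IsCritical m f q) {u : ℝ → M}
    (hu : FlowsAfter g f T u) (huc : Continuous u) (huq : Tendsto u atTop (𝓝 q)) {φ : M → ℝ}
    (hφ : ContMDiff 𝓘(ℝ, Model m) 𝓘(ℝ, ℝ) ∞ φ) :
    MemLp (fun t ↦ φ (u t) - φ q) 2 (volume.restrict (Ici 0)) := by
  obtain ⟨C, hC⟩ := hf.eventually_sub_sq_le g hq hφ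
  exact hu.memLp_two hf.smooth huc ((hφ.continuous.comp huc).sub continuous_const)
    (huq.eventually hC)

theorem FlowsAfter.memLp_deriv (hf : ContMDiff 𝓘(ℝ, Model m) 𝓘(ℝ, ℝ) ∞ f) {u : ℝ → M}
    (hu : FlowsAfter g f T u) (huc : Continuous u) {φ : M → ℝ}
    (hφ : ContMDiff 𝓘(ℝ, Model m) 𝓘(ℝ, ℝ) ∞ φ) (hd : Continuous (deriv fun t ↦ φ (u t))) :
    MemLp (deriv fun t ↦ φ (u t)) 2 (volume.restrict (Ici 0)) := by
  obtain ⟨C, -, hC⟩ := exists_sq_deriv_le hφ f g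
  exact hu.memLp_two hf huc hd ((eventually_gt_atTop T).mono fun t ht ↦ hC u t (hu t ht))

theorem memLp_Iic_of_comp_neg {b : ℝ → ℝ} {p : ℝ≥0∞}
    (h : MemLp (fun t ↦ b (-t)) p (volume.restrict (Ici 0))) :
    MemLp b p (volume.restrict (Iic 0)) := by
  have h1 := (Measure.measurePreserving_neg (volume : Measure ℝ)).restrict_preimage
    (measurableSet_Ici (a := (0 : ℝ)))
  simpa [Function.comp_def] using h.comp_measurePreserving h1

theorem tendsto_lintegral_sq_sub_comp (hf : IsMorse m f) {u : ℕ → ℝ → M} {w : ℝ → M} {q : M}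
    (hq : IsCritical m f q) (hu : ∀ ν, FlowsAfter g f T (u ν)) (huc : ∀ ν, Continuous (u ν))
    (huq : ∀ ν, Tendsto (u ν) atTop (𝓝 q)) (hw : FlowsAfter g f T w) (hwc : Continuous w)
    (hwq : Tendsto w atTop (𝓝 q)) (h : LocConv u w) {V : Set M}
    (hV : IsIsolating (m := m) f q V) (hstay : ∃ R, ∀ᶠ ν in atTop, ∀ t ≥ R, u ν t ∈ V)
    {φ : M → ℝ} (hφ : ContMDiff 𝓘(ℝ, Model m) 𝓘(ℝ, ℝ) ∞ φ) :
    Tendsto (fun ν ↦ ∫⁻ t in Ici 0, ENNReal.ofReal ((φ (u ν t) - φ (w t)) ^ 2)) atTop (𝓝 0) := by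
  obtain ⟨C, hC, hle⟩ := hf.exists_sub_sq_le g hq hV hφ
  obtain ⟨R, hR⟩ := hstay
  have := tendsto_lintegral_sq_sub hf.smooth hu huc huq hw hwc hwq h
    (b := fun ν t ↦ φ (u ν t) - φ q) (b₀ := fun t ↦ φ (w t) - φ q)
    ((hφ.continuous.comp hwc).sub continuous_const)
    (h.comp_continuous (hφ.continuous.sub continuous_const)) hC
    ((hwq.eventually hV.mem_nhds).mono fun t ht ↦ hle _ ht)
    ⟨R, hR.mono fun ν hν t ht ↦ hle _ (hν t ht)⟩
  simpa using this

/-- Derivatives are dominated by the energy density on all of `M`, so unlike for the values of `φ`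
no isolating neighbourhood is required. -/
theorem tendsto_lintegral_sq_sub_deriv (hf : ContMDiff 𝓘(ℝ, Model m) 𝓘(ℝ, ℝ) ∞ f)
    {u : ℕ → ℝ → M} {w : ℝ → M} {q : M}
    (hu : ∀ ν, FlowsAfter g f T (u ν)) (huc : ∀ ν, Continuous (u ν))
    (huq : ∀ ν, Tendsto (u ν) atTop (𝓝 q)) (hw : FlowsAfter g f T w) (hwc : Continuous w)
    (hwq : Tendsto w atTop (𝓝 q)) (h : LocConv u w)
    {φ : M → ℝ} (hφ : ContMDiff 𝓘(ℝ, Model m) 𝓘(ℝ, ℝ) ∞ φ)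
    (hd : Continuous (deriv fun t ↦ φ (w t)))
    (hconv : LocConv (fun ν ↦ deriv fun t ↦ φ (u ν t)) (deriv fun t ↦ φ (w t))) :
    Tendsto (fun ν ↦ ∫⁻ t in Ici 0, ENNReal.ofReal
      ((deriv (fun t ↦ φ (u ν t)) t - deriv (fun t ↦ φ (w t)) t) ^ 2)) atTop (𝓝 0) := by
  obtain ⟨C, hC, hle⟩ := exists_sq_deriv_le hφ f g
  exact tendsto_lintegral_sq_sub hf hu huc huq hw hwc hwq h hd hconv hC
    ((eventually_gt_atTop T).mono fun t ht ↦ hle w t (hw t ht))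
    ⟨T + 1, Eventually.of_forall fun ν t ht ↦ hle (u ν) t (hu ν t (by linarith))⟩

end HalfLine

/-! ### Sobolev regularity and convergence on the whole line. -/

section Paths

variable {m ℓ : ℕ} {M : Type*} [TopologicalSpace M] [ChartedSpace (Model m) M]
  [IsManifold 𝓘(ℝ, Model m) ∞ M] {fα fβ : M → ℝ} {gα gβ : Metric m M}
  {H : (Fin ℓ → ℝ) → ℝ → M → ℝ} {G : (Fin ℓ → ℝ) → ℝ → Metric m M}

theorem IsFlowLine.continuous {g : ℝ → Metric m M} {h : ℝ → M → ℝ} {u : ℝ → M}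
    (hu : IsFlowLine g h u) : Continuous u :=
  continuous_iff_continuousAt.2 fun t ↦ (hu t).continuousAt

theorem IsHomotopy.exists_flowsAfter (hHG : IsHomotopy fα gα fβ gβ H G) :
    ∃ T, 0 < T ∧ ∀ s ∈ cube ℓ, ∀ u : ℝ → M, IsFlowLine (G s) (H s) u →
      FlowsAfter gβ fβ T u ∧ FlowsAfter gα (-fα) T (fun t ↦ u (-t)) := by
  obtain ⟨T, hT, hfin⟩ := hHG.finite
  refine ⟨T, hT, fun s hs u hu ↦ ⟨fun t ht ↦ ?_, FlowsAfter.of_reverse fun t ht ↦ ?_⟩⟩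
  · obtain ⟨h1, h2⟩ := (hfin s hs).2 t ht
    have := hu t
    rwa [h1, h2] at this
  · obtain ⟨h1, h2⟩ := (hfin s hs).1 t ht
    have := hu t
    rwa [h1, h2] at this

theorem IsHomotopy.deriv_comp_eq (hHG : IsHomotopy fα gα fβ gβ H G) {s : Fin ℓ → ℝ}
    (hs : s ∈ cube ℓ) {u : ℝ → M} (hu : IsFlowLine (G s) (H s) u) {φ : M → ℝ}
    (hφ : ContMDiff 𝓘(ℝ, Model m) 𝓘(ℝ, ℝ) ∞ φ) :
    (deriv fun t ↦ φ (u t)) = fun t ↦ flowDeriv H G φ 1 ((s, t), u t) :=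
  funext fun t ↦ (hasDerivAt_flowDeriv hHG hφ 0 hs (hu t)).deriv

theorem IsHomotopy.continuous_deriv_comp (hHG : IsHomotopy fα gα fβ gβ H G) {s : Fin ℓ → ℝ}
    (hs : s ∈ cube ℓ) {u : ℝ → M} (hu : IsFlowLine (G s) (H s) u) {φ : M → ℝ}
    (hφ : ContMDiff 𝓘(ℝ, Model m) 𝓘(ℝ, ℝ) ∞ φ) : Continuous (deriv fun t ↦ φ (u t)) := by
  rw [hHG.deriv_comp_eq hs hu hφ]
  exact continuous_comp_domain hs hu.continuous (contMDiffOn_flowDeriv hHG hφ 1).continuousOn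

theorem deriv_comp_neg_fun (b : ℝ → ℝ) : (deriv fun t ↦ b (-t)) = fun t ↦ -deriv b (-t) :=
  funext fun t ↦ deriv_comp_neg b t

variable [CompactSpace M]

/-- Flow lines of a homotopy which converge to critical points of Morse functions are
`W^{1,2}`-paths. -/
theorem IsHomotopy.isW12Path (hHG : IsHomotopy fα gα fβ gβ H G) (hfα : IsMorse m fα)
    (hfβ : IsMorse m fβ) {p q : M} (hp : IsCritical m fα p) (hq : IsCritical m fβ q)
    {s : Fin ℓ → ℝ} (hs : s ∈ cube ℓ) {u : ℝ → M} (hu : IsFlowLine (G s) (H s) u)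
    (hbot : Tendsto u atBot (𝓝 p)) (htop : Tendsto u atTop (𝓝 q)) : IsW12Path m p q u := by
  obtain ⟨T, hT, hflow⟩ := hHG.exists_flowsAfter
  obtain ⟨hr, hl⟩ := hflow s hs u hu
  have huc := hu.continuous
  have huc' : Continuous fun t ↦ u (-t) := huc.comp continuous_neg
  refine ⟨huc, hbot, htop, fun φ hφ ↦ ?_, fun φ hφ ↦ ?_, fun φ hφ ↦
    hr.memLp_sub hfβ hq huc htop hφ⟩
  · have hd := hHG.continuous_deriv_comp hs hu hφ
    refine ⟨deriv fun t ↦ φ (u t), ?_, fun a b ↦ ?_⟩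
    · have h1 := hr.memLp_deriv hfβ.smooth huc hφ hd
      have h2 : MemLp (deriv fun t ↦ φ (u t)) 2 (volume.restrict (Iic 0)) := by
        refine memLp_Iic_of_comp_neg ?_
        have h3 := deriv_comp_neg_fun fun t ↦ φ (u t)
        have h4 := hl.memLp_deriv hfα.neg.smooth huc' hφ (by
          rw [h3]; exact (hd.comp continuous_neg).neg)
        rw [h3] at h4
        simpa [Pi.neg_def] using h4.neg
      rw [memLp_two_iff_integrable_sq hd.aestronglyMeasurable] at h1 h2 ⊢
      rw [← integrableOn_univ, ← Iic_union_Ici (a := (0 : ℝ))]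
      exact IntegrableOn.union h2 h1
    · refine (intervalIntegral.integral_deriv_eq_sub (fun t _ ↦ ?_)
        (hd.intervalIntegrable a b)).symm
      exact (hasDerivAt_flowDeriv hHG hφ 0 hs (hu t)).differentiableAt
  · exact memLp_Iic_of_comp_neg (b := fun t ↦ φ (u t) - φ p)
      (hl.memLp_sub hfα.neg (isCritical_neg.2 hp) huc' (hbot.comp tendsto_neg_atTop_atBot) hφ)

/-- Locally uniform convergence of flow lines of a homotopy, together with uniform control at the
ends, implies convergence in `W^{1,2}`. -/
theorem IsHomotopy.tendstoW12 (hHG : IsHomotopy fα gα fβ gβ H G) (hfα : IsMorse m fα)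
    (hfβ : IsMorse m fβ) {p q : M} (hp : IsCritical m fα p) (hq : IsCritical m fβ q)
    {s : ℕ → Fin ℓ → ℝ} {s₀ : Fin ℓ → ℝ} (hs : ∀ ν, s ν ∈ cube ℓ) (hs₀ : s₀ ∈ cube ℓ)
    (hlim : Tendsto s atTop (𝓝 s₀)) {u : ℕ → ℝ → M} {w : ℝ → M}
    (hu : ∀ ν, IsFlowLine (G (s ν)) (H (s ν)) (u ν)) (hubot : ∀ ν, Tendsto (u ν) atBot (𝓝 p))
    (hutop : ∀ ν, Tendsto (u ν) atTop (𝓝 q)) (hw : IsFlowLine (G s₀) (H s₀) w)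
    (hwbot : Tendsto w atBot (𝓝 p)) (hwtop : Tendsto w atTop (𝓝 q)) (h : LocConv u w)
    {V W : Set M} (hV : IsIsolating (m := m) fβ q V)
    (hstayV : ∃ R, ∀ᶠ ν in atTop, ∀ t ≥ R, u ν t ∈ V) (hW : IsIsolating (m := m) (-fα) p W)
    (hstayW : ∃ R, ∀ᶠ ν in atTop, ∀ t ≥ R, u ν (-t) ∈ W) : TendstoW12 m u w := by
  obtain ⟨T, hT, hflow⟩ := hHG.exists_flowsAfter
  have huc := fun ν ↦ (hu ν).continuous
  have hwc := hw.continuous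
  have hur := fun ν ↦ (hflow _ (hs ν) _ (hu ν)).1
  have hul := fun ν ↦ (hflow _ (hs ν) _ (hu ν)).2
  have huc' := fun ν ↦ (huc ν).comp continuous_neg
  have hwc' := hwc.comp continuous_neg
  have hubot' := fun ν ↦ (hubot ν).comp tendsto_neg_atTop_atBot
  have hwbot' := hwbot.comp tendsto_neg_atTop_atBot
  intro φ hφ
  have hd := hHG.continuous_deriv_comp hs₀ hw hφ
  have hconv : LocConv (fun ν ↦ deriv fun t ↦ φ (u ν t)) (deriv fun t ↦ φ (w t)) := by
    rw [hHG.deriv_comp_eq hs₀ hw hφ]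
    simp_rw [fun ν ↦ hHG.deriv_comp_eq (hs ν) (hu ν) hφ]
    exact h.comp_domain hs hs₀ hlim (contMDiffOn_flowDeriv hHG hφ 1).continuousOn
  constructor
  · refine tendsto_eLpNorm_two_of_halves ?_ ?_
    · exact tendsto_lintegral_sq_sub_comp hfβ hq hur huc hutop (hflow _ hs₀ _ hw).1 hwc hwtop h hV
        hstayV hφ
    · exact tendsto_lintegral_sq_sub_comp hfα.neg (isCritical_neg.2 hp) hul huc' hubot'
        (hflow _ hs₀ _ hw).2 hwc' hwbot' h.comp_neg hW hstayW hφ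
  · refine tendsto_eLpNorm_two_of_halves ?_ ?_
    · exact tendsto_lintegral_sq_sub_deriv hfβ.smooth hur huc hutop (hflow _ hs₀ _ hw).1 hwc hwtop h
        hφ hd hconv
    · have h1 := deriv_comp_neg_fun fun t ↦ φ (w t)
      have h2 := fun ν ↦ deriv_comp_neg_fun fun t ↦ φ (u ν t)
      have h3 := tendsto_lintegral_sq_sub_deriv hfα.neg.smooth hul huc' hubot'
        (hflow _ hs₀ _ hw).2 hwc' hwbot' h.comp_neg hφ
        (by rw [h1]; exact (hd.comp continuous_neg).neg)
        (by rw [h1]; simp_rw [h2]; exact hconv.comp_neg.comp_continuous continuous_neg)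
      refine h3.congr fun ν ↦ lintegral_congr fun t ↦ ?_
      rw [h1, h2 ν]
      congr 1
      ring

end Paths

/-! ### Assembling the broken line. -/

section Assembly

variable {m ℓ : ℕ} {M : Type*} [TopologicalSpace M] [ChartedSpace (Model m) M]
  [IsManifold 𝓘(ℝ, Model m) ∞ M] {fα fβ : M → ℝ} {gα gβ : Metric m M}
  {H : (Fin ℓ → ℝ) → ℝ → M → ℝ} {G : (Fin ℓ → ℝ) → ℝ → Metric m M}

theorem IsFlowLine.mem_connectingAutonomous [CompactSpace M] {f : M → ℝ} {g : Metric m M}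
    (hf : IsMorse m f) {u : ℝ → M} (hu : IsFlowLine (fun _ ↦ g) (fun _ ↦ f) u) {p q : M}
    (hp : IsCritical m f p) (hq : IsCritical m f q) (hbot : Tendsto u atBot (𝓝 p))
    (htop : Tendsto u atTop (𝓝 q)) : u ∈ connectingAutonomous g f p q :=
  ⟨(IsHomotopy.const 0 hf.smooth g).isW12Path hf hf hp hq (zero_mem_cube 0) hu hbot htop, hu⟩

theorem LocConv.tendstoCinftyLoc_of_autonomous [T2Space M] {f : M → ℝ} {g : Metric m M}
    (hf : ContMDiff 𝓘(ℝ, Model m) 𝓘(ℝ, ℝ) ∞ f) {u : ℕ → ℝ → M} {w : ℝ → M} (hw : Continuous w)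
    (h : LocConv u w) (hu : ∀ t, ∀ᶠ y : ℕ × ℝ in atTop ×ˢ 𝓝 t,
      HasMFDerivAt 𝓘(ℝ, ℝ) 𝓘(ℝ, Model m) (u y.1) y.2
        ((1 : ℝ →L[ℝ] ℝ).smulRight (-gradient g f (u y.1 y.2)))) : TendstoCinftyLoc m u w :=
  h.tendstoCinftyLoc (IsHomotopy.const 0 hf g) (s := fun _ ↦ 0) (s₀ := 0)
    (fun _ ↦ zero_mem_cube 0) (zero_mem_cube 0) tendsto_const_nhds hw hu

variable [T2Space M] [CompactSpace M] {p q a b : M} {z : ℕ → (Fin ℓ → ℝ) × (ℝ → M)}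
  {s₀ : Fin ℓ → ℝ} {w : ℝ → M} {N N' : ℕ} {cs cs' : ℕ → M} {ws ws' : ℕ → ℝ → M}
  {rs rs' : ℕ → ℕ → ℝ}

/-- The broken line consisting of a reversed chain of flow lines of `-fα`, a flow line of the
homotopy, and a chain of flow lines of `fβ`. -/
def brokenLineOfChains (hfα : IsMorse m fα) (hfβ : IsMorse m fβ)
    (hw : (s₀, w) ∈ moduli H G a b)
    (hL : IsChain gα (-fα) (fun ν t ↦ (z ν).2 (-t)) a p N cs ws rs)
    (hR : IsChain gβ fβ (fun ν ↦ (z ν).2) b q N' cs' ws' rs') (hN : 0 < N + N') :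
    BrokenLine fα gα fβ gβ H G p q where
  n := N + 1 + N'
  two_le := by omega
  k₀ := ⟨N, by omega⟩
  s₀ := s₀
  -- The left chain starts at `a` and runs to `p` in reversed time, so its pieces are listed
  -- backwards and traversed in the opposite direction; index `N` is the homotopy piece.
  u k := if k.val < N then fun t ↦ ws (N - 1 - k) (-t) else
    if k.val = N then w else ws' (k - N - 1)
  -- Thus `c 0 = p`, `c N = a`, `c (N + 1) = b` and `c (N + 1 + N') = q`.
  c i := if i.val ≤ N then cs (N - i) else cs' (i - N - 1)
  c_zero := by simp [hL.last]
  c_last := by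
    have h1 : ¬ N + 1 + N' ≤ N := by omega
    have h2 : N + 1 + N' - N - 1 = N' := by omega
    simp [h1, h2, hR.last]
  critical_left i hi := by
    have h1 : i.val ≤ N := hi
    rw [if_pos h1]
    exact isCritical_neg.1 (hL.critical _ (by omega))
  critical_right i hi := by
    have h1 : N + 1 ≤ i.val := hi
    have h2 := i.2
    rw [if_neg (by omega)]
    exact hR.critical _ (by omega)
  mem_left k hk := by
    have h1 : k.val < N := hk
    have h2 : N - 1 - k.val < N := by omega
    have h3 : k.val + 1 ≤ N := h1
    have h4 : N - 1 - k.val + 1 = N - k.val := by omega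
    have h5 : N - (k.val + 1) = N - 1 - k.val := by omega
    simp only [h1, Fin.val_castSucc, h1.le, Fin.val_succ, h3, if_true]
    refine IsFlowLine.mem_connectingAutonomous hfα ?_ (isCritical_neg.1 (hL.critical _ (by omega)))
      (isCritical_neg.1 (hL.critical _ (by omega))) ?_ ?_
    · simpa using (hL.flow _ h2).reverse
    · rw [← h4]
      exact (hL.tendsto_atTop _ h2).comp tendsto_neg_atBot_atTop
    · rw [h5]
      exact (hL.tendsto_atBot _ h2).comp tendsto_neg_atTop_atBot
  mem_middle := by simpa [hL.zero, hR.zero] using hw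
  mem_right k hk := by
    have h1 : N < k.val := hk
    have h2 := k.2
    have h3 : k.val - N - 1 < N' := by omega
    have h4 : k.val + 1 - N - 1 = k.val - N - 1 + 1 := by omega
    simp only [Fin.val_castSucc, Fin.val_succ, if_neg h1.not_ge, if_neg h1.ne', if_neg h1.not_gt,
      if_neg (show ¬ k.val + 1 ≤ N by omega), h4]
    exact (hR.flow _ h3).mem_connectingAutonomous hfβ (hR.critical _ h3.le)
      (hR.critical _ h3) (hR.tendsto_atBot _ h3) (hR.tendsto_atTop _ h3)
  nonconstant k hk x := by
    have h2 := k.2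
    have hk' : k.val ≠ N := fun h ↦ hk (Fin.ext h)
    rcases lt_or_gt_of_ne hk' with h | h
    · rw [if_pos h]
      intro hx
      refine hL.nonconstant (N - 1 - k) (by omega) x (funext fun t ↦ ?_)
      simpa using congrFun hx (-t)
    · rw [if_neg h.not_gt, if_neg h.ne']
      exact hR.nonconstant _ (by omega) x

theorem floerGromovTendsto_brokenLineOfChains (hHG : IsHomotopy fα gα fβ gβ H G)
    (hfα : IsMorse m fα) (hfβ : IsMorse m fβ) (hs : ∀ ν, (z ν).1 ∈ cube ℓ)
    (hflow : ∀ ν, IsFlowLine (G (z ν).1) (H (z ν).1) (z ν).2)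
    (hs₀ : Tendsto (fun ν ↦ (z ν).1) atTop (𝓝 s₀)) (hlim : LocConv (fun ν ↦ (z ν).2) w)
    (hw : (s₀, w) ∈ moduli H G a b)
    (hL : IsChain gα (-fα) (fun ν t ↦ (z ν).2 (-t)) a p N cs ws rs)
    (hR : IsChain gβ fβ (fun ν ↦ (z ν).2) b q N' cs' ws' rs') (hN : 0 < N + N') :
    FloerGromovTendsto z (brokenLineOfChains hfα hfβ hw hL hR hN) := by
  obtain ⟨T, hT, hfin⟩ := hHG.finite
  refine ⟨hs₀, fun k ν ↦ if k.val < N then -rs (N - 1 - k) ν else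
    if k.val = N then 0 else rs' (k - N - 1) ν, fun ν ↦ by simp [brokenLineOfChains], fun k ↦ ?_⟩
  have hk : k.val < N + 1 + N' := k.2
  simp only [brokenLineOfChains]
  rcases lt_trichotomy k.val N with h | h | h
  · have h1 : N - 1 - k.val < N := by omega
    simp only [h, if_true]
    refine LocConv.tendstoCinftyLoc_of_autonomous (g := gα) hfα.smooth
      ((hL.continuous _ h1).comp continuous_neg) ?_ fun t ↦ ?_
    · simpa [neg_add, add_comm] using (hL.locConv _ h1).comp_neg
    -- Together with `τ < t + 1` this gives `τ - rs < -T`, where the homotopy equals `(fα, gα)`.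
    · have h2 := (hL.shift _ h1).eventually_gt_atTop (T + t + 1)
      have h3 : ∀ᶠ τ in 𝓝 t, τ < t + 1 := eventually_lt_nhds (by linarith)
      refine (h2.prod_mk h3).mono fun y hy ↦ hasMFDerivAt_comp_add ?_
      obtain ⟨h4, h5⟩ := (hfin _ (hs y.1)).1 (y.2 + -rs (N - 1 - k.val) y.1)
        (by linarith [hy.1, hy.2])
      have h6 := hflow y.1 (y.2 + -rs (N - 1 - k.val) y.1)
      rwa [h4, h5] at h6
  · simp only [h, lt_irrefl, if_true, if_false, add_zero]
    exact hlim.tendstoCinftyLoc hHG hs hw.1 hs₀ hw.2.1.continuous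
      fun t ↦ Eventually.of_forall fun y ↦ hflow y.1 y.2
  · have h1 : k.val - N - 1 < N' := by omega
    simp only [if_neg h.not_gt, if_neg h.ne']
    refine LocConv.tendstoCinftyLoc_of_autonomous (g := gβ) hfβ.smooth (hR.continuous _ h1)
      (hR.locConv _ h1) fun t ↦ ?_
    have h2 := (hR.shift _ h1).eventually_gt_atTop (T - t + 1)
    have h3 : ∀ᶠ τ in 𝓝 t, t - 1 < τ := eventually_gt_nhds (by linarith)
    refine (h2.prod_mk h3).mono fun y hy ↦ hasMFDerivAt_comp_add ?_
    obtain ⟨h4, h5⟩ := (hfin _ (hs y.1)).2 (y.2 + rs' (k.val - N - 1) y.1)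
      (by linarith [hy.1, hy.2])
    have h6 := hflow y.1 (y.2 + rs' (k.val - N - 1) y.1)
    rwa [h4, h5] at h6

/-- After passing to a subsequence, flow lines of a homotopy converge locally uniformly. -/
theorem IsHomotopy.exists_subseq_locConv (hHG : IsHomotopy fα gα fβ gβ H G) {n : ℕ}
    {e : M → Fin n → ℝ} (he : IsClosedEmbedding e) {K : NNReal} (hs : ∀ ν, (z ν).1 ∈ cube ℓ)
    (hflow : ∀ ν, IsFlowLine (G (z ν).1) (H (z ν).1) (z ν).2)
    (hLip : ∀ ν, LipschitzWith K (fun t ↦ e ((z ν).2 t))) :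
    ∃ j : ℕ → ℕ, StrictMono j ∧ ∃ s₀ ∈ cube ℓ, ∃ w : ℝ → M,
      Tendsto (fun ν ↦ (z (j ν)).1) atTop (𝓝 s₀) ∧ LocConv (fun ν ↦ (z (j ν)).2) w ∧
      IsFlowLine (G s₀) (H s₀) w := by
  obtain ⟨s₀, hs₀, i, hi, hlim⟩ := isCompact_Icc.tendsto_subseq hs
  obtain ⟨k, hk, w, hwc, hw⟩ := HigherMorse.exists_subseq_locConv he
    (u := fun ν ↦ (z (i ν)).2) fun ν ↦ hLip _
  have hlim' := hlim.comp hk.tendsto_atTop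
  exact ⟨fun ν ↦ i (k ν), hi.comp hk, s₀, hs₀, w, hlim', hw,
    hw.isFlowLine hHG (fun ν ↦ hs _) hs₀ hlim' hwc
      fun t ↦ Eventually.of_forall fun y ↦ hflow _ y.2⟩

end Assembly

end HigherMorse

end

/-! ### The compactness theorem. -/

open HigherMorse in
theorem mainTheorem3 {m ℓ : ℕ} {M : Type*} [TopologicalSpace M] [T2Space M] [CompactSpace M]
    [ChartedSpace (HigherMorse.Model m) M]
    [IsManifold (modelWithCornersSelf ℝ (HigherMorse.Model m)) ∞ M]
    (fα fβ : M → ℝ) (gα gβ : HigherMorse.Metric m M)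
    (hfα : HigherMorse.IsMorse m fα) (hfβ : HigherMorse.IsMorse m fβ)
    (H : (Fin ℓ → ℝ) → ℝ → M → ℝ) (G : (Fin ℓ → ℝ) → ℝ → HigherMorse.Metric m M)
    (hHG : HigherMorse.IsHomotopy fα gα fβ gβ H G)
    (p q : M) (hp : HigherMorse.IsCritical m fα p) (hq : HigherMorse.IsCritical m fβ q)
    (z : ℕ → (Fin ℓ → ℝ) × (ℝ → M)) (hz : ∀ ν, z ν ∈ HigherMorse.moduli H G p q) :
    ∃ j : ℕ → ℕ, StrictMono j ∧
      (¬ HigherMorse.ConvergesInModuli H G p q (z ∘ j) →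
        ∃ y : HigherMorse.BrokenLine fα gα fβ gβ H G p q,
          HigherMorse.FloerGromovTendsto (z ∘ j) y) := by
  obtain ⟨n, e, he, hsmooth⟩ := exists_isClosedEmbedding_pi m M
  obtain ⟨K, hK⟩ := hHG.exists_lipschitzWith hsmooth
  obtain ⟨T, -, hends⟩ := hHG.exists_flowsAfter
  have hs : ∀ ν, (z ν).1 ∈ cube ℓ := fun ν ↦ (hz ν).1
  have hflow : ∀ ν, IsFlowLine (G (z ν).1) (H (z ν).1) (z ν).2 := fun ν ↦ (hz ν).2.2
  have hLip := fun ν ↦ hK _ (hs ν) _ (hflow ν)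
  have hends' := fun ν ↦ hends _ (hs ν) _ (hflow ν)
  have hcont : ∀ ν, Continuous (z ν).2 := fun ν ↦ (hflow ν).continuous
  obtain ⟨i, hi, s₀, hs₀, w, hlim, hloc, hw⟩ := hHG.exists_subseq_locConv he hs hflow hLip
  obtain ⟨b, hb, htop⟩ := (hends s₀ hs₀ w hw).1.exists_tendsto hfβ hw.continuous
  obtain ⟨a, ha, hbot'⟩ := (hends s₀ hs₀ w hw).2.exists_tendsto hfα.neg
    (hw.continuous.comp continuous_neg)
  have hbot : Tendsto w atBot (𝓝 a) := by
    simpa [Function.comp_def] using hbot'.comp tendsto_neg_atBot_atTop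
  -- Both chains are started with shift `0`, because the homotopy piece is not shifted; the second
  -- one is built for `-fα` and the reversed curves.
  obtain ⟨k, hk, N', cs', ws', rs', hR, hR₀⟩ := exists_chain hfβ he hq (u := fun ν ↦ (z (i ν)).2)
    (fun ν ↦ hcont _) (fun ν ↦ hLip _) (fun ν ↦ (hends' _).1)
    (fun ν ↦ (hz _).2.1.tendsto_atTop) (r := 0) (Eventually.of_forall fun _ ↦ le_rfl)
    (by simpa using hloc) hb htop
  obtain ⟨k', hk', N, cs, ws, rs, hL, hL₀⟩ := exists_chain hfα.neg he (isCritical_neg.2 hp)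
    (u := fun ν t ↦ (z (i (k ν))).2 (-t)) (fun ν ↦ (hcont _).comp continuous_neg)
    (fun ν x y ↦ by simpa using hLip (i (k ν)) (-x) (-y)) (fun ν ↦ (hends' _).2)
    (fun ν ↦ (hz _).2.1.tendsto_atBot.comp tendsto_neg_atTop_atBot) (r := 0)
    (Eventually.of_forall fun _ ↦ le_rfl) (by simpa using (hloc.subseq hk).comp_neg) ha hbot'
  have hj : StrictMono fun ν ↦ k (k' ν) := hk.comp hk'
  have hlim' := hlim.comp hj.tendsto_atTop
  have hloc' := hloc.subseq hj
  have hmem : (s₀, w) ∈ moduli H G a b :=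
    ⟨hs₀, hHG.isW12Path hfα hfβ (isCritical_neg.1 ha) hb hs₀ hw hbot htop, hw⟩
  refine ⟨fun ν ↦ i (k (k' ν)), hi.comp hj, fun hnot ↦ ?_⟩
  -- Two empty chains mean `a = p`, `b = q` and uniform control at both ends, hence convergence in
  -- the moduli space; otherwise the broken line has at least two pieces.
  rcases Nat.eq_zero_or_pos (N + N') with hN | hN
  · obtain ⟨rfl, rfl⟩ : N = 0 ∧ N' = 0 := by omega
    obtain rfl : a = p := hL.zero.symm.trans hL.last
    obtain rfl : b = q := hR.zero.symm.trans hR.last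
    obtain ⟨V, hV, R, hstayV⟩ := hR₀ rfl
    obtain ⟨W, hW, R', hstayW⟩ := hL₀ rfl
    refine absurd ⟨(s₀, w), hmem, hlim', ?_⟩ hnot
    exact hHG.tendstoW12 hfα hfβ hp hq (fun ν ↦ hs _) hs₀ hlim' (fun ν ↦ hflow _)
      (fun ν ↦ (hz _).2.1.tendsto_atBot) (fun ν ↦ (hz _).2.1.tendsto_atTop) hw hbot htop hloc' hV
      ⟨R, (hk'.tendsto_atTop.eventually hstayV).mono fun ν hν t ht ↦ by simpa using hν t ht⟩ hW
      ⟨R', hstayW.mono fun ν hν t ht ↦ by simpa using hν t ht⟩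
  · exact ⟨_, floerGromovTendsto_brokenLineOfChains (z := fun ν ↦ z (i (k (k' ν)))) hHG hfα hfβ
      (fun ν ↦ hs _) (fun ν ↦ hflow _) hlim' hloc' hmem hL (hR.subseq hk') hN⟩
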